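/- **Theorem 4.3 (Cuntz–Krieger Uniqueness Theorem).** *Setting.* Let $k\in\mathbb N$. A $k$-graph $(\Lambda,d)$ is a countable category $\Lambda$ (with range and source maps $r,s$; composition $\lambda\mu$ is defined when $s(\lambda)=r(\mu)$) together with a functor $d:\Lambda\to\mathbb N^k$ such that whenever $d(\lambda)=m+n$ there are unique $\mu,\nu\in\Lambda$ with $\lambda=\mu\nu$, $d(\mu)=m$, $d(\nu)=n$. Objects are identified with the elements of $\Lambda^0=d^{-1}(0)$. Let $e_1,\dots,e_k$ be the standard generators of $\mathbb N^k$ and, for $v\in\Lambda^0$ and $m,q\in\mathbb N^k$, put $\Lambda^m(v)=\{\lambda: r(\lambda)=v,\ d(\lambda)=m\}$ and $$\Lambda^{\le q}(v)=\{\lambda: r(\lambda)=v,\ d(\lambda)\le q,\ \text{and } \Lambda^{e_i}(s(\lambda))=\emptyset \text{ whenever } d(\lambda)+e_i\le q\}.$$ $\Lambda$ is *row-finite* if every $\Lambda^m(v)$ is finite, and *locally convex* if for all $v$, all $i\ne j$, all $\lambda\in\Lambda^{e_i}(v)$ and $\mu\in\Lambda^{e_j}(v)$, both $\Lambda^{e_j}(s(\lambda))$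 and $\Lambda^{e_i}(s(\mu))$ are nonempty. For $m\in(\mathbb N\cup\{\infty\})^k$ let $\Omega_{k,m}$ be the $k$-graph with objects $\{p\in\mathbb N^k:p\le m\}$ and morphisms $(p,q)$ for $p\le q$, where $r(p,q)=p$, $s(p,q)=q$, $d(p,q)=q-p$. A *boundary path* is a degree-preserving functor $x:\Omega_{k,m}\to\Lambda$ for some $m=:d(x)$, such that whenever $(\Omega_{k,m})^{\le e_i}(p)=\{p\}$ also $\Lambda^{\le e_i}(x(p))=\{x(p)\}$; its range is $r(x)=x(0)$. For $\alpha\in\Lambda$ with $s(\alpha)=r(x)$, $\alpha x$ is the degree-preserving functor $\Omega_{k,d(\alpha)+d(x)}\to\Lambda$ for which $(\alpha x)(0,q)$ is the initial segment of degree $q$ of $\alpha\, x(0,(q-d(\alpha))\vee 0)$, for all $q\le d(\alpha)+d(x)$ in $\mathbb N^k$. A *Cuntz–Krieger $\Lambda$-family* in a $C^*$-algebra $B$ (for row-finite $\Lambda$) is a family of partial isometries $\{t_\lambda:\lambda\in\Lambda\}\subset B$ such that (1) $\{t_v:v\in\Lambda^0\}$ are mutually orthogonal projections; (2) $t_{\lambda\mu}=t_\lambda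 t_\mu$ when $s(\lambda)=r(\mu)$; (3) $t_\lambda^*t_\lambda=t_{s(\lambda)}$; (4) $t_v=\sum_{\lambda\in\Lambda^{\le m}(v)}t_\lambda t_\lambda^*$ for all $v\in\Lambda^0$, $m\in\mathbb N^k$. $C^*(\Lambda)$ denotes the $C^*$-algebra generated by a universal Cuntz–Krieger $\Lambda$-family $\{s_\lambda:\lambda\in\Lambda\}$. *Statement.* Let $(\Lambda,d)$ be a locally convex row-finite $k$-graph satisfying (B) for each $v\in\Lambda^0$ there is a boundary path $x$ with $r(x)=v$ such that $\alpha x\neq\beta x$ for all $\alpha\neq\beta$ in $\Lambda$ with $s(\alpha)=s(\beta)=v$. Let $\{t_\lambda:\lambda\in\Lambda\}$ be a Cuntz–Krieger $\Lambda$-family in a $C^*$-algebra $B$, and let $\pi:C^*(\Lambda)\to B$ be the $*$-homomorphism with $\pi(s_\lambda)=t_\lambda$ for all $\lambda\in\Lambda$. If $t_v\ne 0$ for every $v\in\Lambda^0$, then $\pi$ is faithful (injective). -/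

import Mathlib

open CategoryTheory
open scoped ENNReal

universe u v w

/-- A graph of rank `k` (a `k`-graph): a countable category with a degree functor to `ℕ ^ k`
which has the factorisation property.  A path `λ` with range `r(λ) = b` and source `s(λ) = a` is
a morphism `a ⟶ b`, so the product `λ μ` of the paper notation (first `μ`, then `λ`) is
`μ ≫ λ` in Mathlib's notation. -/
class KGraph (k : outParam ℕ) (Λ : Type u) [Category.{v} Λ] where
  countable_obj : Countable Λ
  countable_hom : ∀ a b : Λ, Countable (a ⟶ b)
  deg : ∀ {a b : Λ}, (a ⟶ b) → Fin k → ℕ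
  deg_id : ∀ a : Λ, deg (𝟙 a) = 0
  deg_comp : ∀ {a b c : Λ} (μ : a ⟶ b) (l : b ⟶ c), deg (μ ≫ l) = deg l + deg μ
  factorisation : ∀ {a b : Λ} (l : a ⟶ b) (m n : Fin k → ℕ), deg l = m + n →
    ∃! p : Σ c : Λ, (a ⟶ c) × (c ⟶ b), p.2.1 ≫ p.2.2 = l ∧ deg p.2.2 = m ∧ deg p.2.1 = n

namespace KGraph

section Basic

variable {k : ℕ} {Λ : Type u} [Category.{v} Λ] [KGraph k Λ]

/-- The generator `e_i` of `ℕ ^ k`. -/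
def e (i : Fin k) : Fin k → ℕ := Pi.single i 1

/-- `Λ^m(v)`: the paths of degree `m` with range `v`, each recorded with its source. -/
def paths (m : Fin k → ℕ) (v : Λ) : Set (Σ a : Λ, a ⟶ v) := {l | deg l.2 = m}

/-- `Λ^{≤ q}(v)`: the paths `l` with range `v` and `d(l) ≤ q` such that `Λ^{e_i}(s(l))` is empty
whenever `d(l) + e_i ≤ q`. -/
def pathsUpTo (q : Fin k → ℕ) (v : Λ) : Set (Σ a : Λ, a ⟶ v) :=
  {l | deg l.2 ≤ q ∧ ∀ i : Fin k, deg l.2 + e i ≤ q → paths (e i) l.1 = ∅}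

variable (Λ) in
/-- Every `Λ^m(v)` is finite. -/
class RowFinite : Prop where
  finite_paths : ∀ (v : Λ) (m : Fin k → ℕ), (paths m v).Finite

variable (Λ) in
/-- Local convexity: if `v` receives edges `l` and `μ` of distinct colours `i` and `j`, then
`s(l)` receives an edge of colour `j` and `s(μ)` receives an edge of colour `i`. -/
def LocallyConvex : Prop :=
  ∀ (v : Λ) (i j : Fin k), i ≠ j → ∀ l ∈ paths (e i) v, ∀ μ ∈ paths (e j) v,
    (paths (e j) l.1).Nonempty ∧ (paths (e i) μ.1).Nonempty

theorem finite_pathsUpTo [RowFinite Λ] (q : Fin k → ℕ) (v : Λ) : (pathsUpTo q v).Finite := by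
  refine Set.Finite.subset
    ((Set.finite_Iic q).biUnion fun m _ => RowFinite.finite_paths v m) ?_
  intro l hl
  simp only [Set.mem_iUnion]
  exact ⟨deg l.2, hl.1, rfl⟩

theorem factorisation_unique {a b c c' : Λ} {g : a ⟶ c} {h : c ⟶ b} {g' : a ⟶ c'} {h' : c' ⟶ b}
    (H : g ≫ h = g' ≫ h') (hd : deg h = deg h') :
    (⟨c, g, h⟩ : Σ c : Λ, (a ⟶ c) × (c ⟶ b)) = ⟨c', g', h'⟩ := by
  have h1 : deg g = deg g' := by
    have := congrArg deg H
    rw [deg_comp, deg_comp, hd] at this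
    exact add_left_cancel this
  exact (factorisation (g ≫ h) (deg h) (deg g) (deg_comp g h)).unique
    ⟨rfl, rfl, rfl⟩ ⟨H.symm, hd.symm, h1.symm⟩

/-- If two paths `h`, `h'` are initial segments (range ends) of the same path and
`d(h') ≤ d(h)`, then `h = h' e'` for a unique path `e'`. -/
theorem existsUnique_lift {a b c c' : Λ} {g : a ⟶ c} {h : c ⟶ b} {g' : a ⟶ c'} {h' : c' ⟶ b}
    (H : g ≫ h = g' ≫ h') (hd : deg h' ≤ deg h) : ∃! e' : c ⟶ c', e' ≫ h' = h := by
  obtain ⟨⟨y, t, i⟩, ⟨h1, h2, -⟩, -⟩ := factorisation h (deg h') (deg h - deg h')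
    (add_tsub_cancel_of_le hd).symm
  have h3 := factorisation_unique (g := g ≫ t) (h := i) (g' := g') (h' := h')
    (by rw [Category.assoc]; exact (congrArg (g ≫ ·) h1).trans H) h2
  cases h3
  refine ⟨t, h1, fun t' ht' => ?_⟩
  have h4 := factorisation_unique (g := t') (h := h') (g' := t) (h' := h')
    (Eq.trans ht' (Eq.symm h1)) rfl
  simpa using h4

/-- The factorisation `l = (init) (tail)` with `d(init) = n`, for `n ≤ d(l)`: the middle
vertex, the tail and the initial segment. -/
noncomputable def split {a b : Λ} (l : a ⟶ b) (n : Fin k → ℕ) (hn : n ≤ deg l) :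
    Σ c : Λ, (a ⟶ c) × (c ⟶ b) :=
  (factorisation l n (deg l - n) (add_tsub_cancel_of_le hn).symm).choose

theorem split_comp {a b : Λ} (l : a ⟶ b) (n : Fin k → ℕ) (hn : n ≤ deg l) :
    (split l n hn).2.1 ≫ (split l n hn).2.2 = l :=
  (factorisation l n (deg l - n) (add_tsub_cancel_of_le hn).symm).choose_spec.1.1

theorem deg_split {a b : Λ} (l : a ⟶ b) (n : Fin k → ℕ) (hn : n ≤ deg l) :
    deg (split l n hn).2.2 = n :=
  (factorisation l n (deg l - n) (add_tsub_cancel_of_le hn).symm).choose_spec.1.2.1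

end Basic

/-- The vertices of `Ω_{k,m}`, for `m ∈ (ℕ ∪ {∞}) ^ k`. -/
@[ext]
structure Omega {k : ℕ} (m : Fin k → ℕ∞) where
  pt : Fin k → ℕ
  le : ∀ i, (pt i : ℕ∞) ≤ m i

namespace Omega

variable {k : ℕ} {m : Fin k → ℕ∞}

/-- There is exactly one path with range `p` and source `q` if `p ≤ q`, and none otherwise. -/
instance : Category.{0} (Omega m) where
  Hom q p := PLift (p.pt ≤ q.pt)
  id p := ⟨le_refl p.pt⟩
  comp f g := ⟨g.down.trans f.down⟩

instance (q p : Omega m) : Subsingleton (q ⟶ p) := inferInstanceAs (Subsingleton (PLift _))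

instance : Countable (Omega m) :=
  Function.Injective.countable (f := Omega.pt) fun _ _ h => Omega.ext h

/-- The path with range `p` and source `q`, for `p ≤ q`. -/
def hom {q p : Omega m} (h : p.pt ≤ q.pt) : q ⟶ p := ⟨h⟩

/-- `Ω_{k,m}` is a `k`-graph, with `d(p, q) = q - p`. -/
instance : KGraph k (Omega m) where
  countable_obj := inferInstance
  countable_hom _ _ := inferInstance
  deg := fun {q p} _ => q.pt - p.pt
  deg_id p := tsub_self p.pt
  deg_comp {a b c} μ l := by
    have h1 : b.pt ≤ a.pt := μ.down
    have h2 : c.pt ≤ b.pt := l.down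
    funext i
    have h3 : b.pt i ≤ a.pt i := h1 i
    have h4 : c.pt i ≤ b.pt i := h2 i
    simp only [Pi.sub_apply, Pi.add_apply]
    omega
  factorisation {a b} l n n' h := by
    have h0 : b.pt ≤ a.pt := l.down
    have hi : ∀ i, a.pt i = b.pt i + n i + n' i := fun i => by
      have h1 := congrFun h i
      have h2 : b.pt i ≤ a.pt i := h0 i
      simp only [Pi.sub_apply, Pi.add_apply] at h1
      omega
    have hle : b.pt + n ≤ a.pt := fun i => by
      have := hi i
      simp only [Pi.add_apply]
      omega
    refine ⟨⟨⟨b.pt + n, fun i => le_trans (by exact_mod_cast hle i) (a.le i)⟩,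
      ⟨hle⟩, ⟨le_self_add⟩⟩, ⟨rfl, ?_, ?_⟩, ?_⟩
    · exact add_tsub_cancel_left b.pt n
    · funext i
      have := hi i
      simp only [Pi.sub_apply, Pi.add_apply]
      omega
    · rintro ⟨c, f, g⟩ ⟨-, h2, -⟩
      have hg : b.pt ≤ c.pt := g.down
      have hc : c = ⟨b.pt + n, fun i => le_trans (by exact_mod_cast hle i) (a.le i)⟩ := by
        ext i
        have h3 := congrFun h2 i
        have h4 : b.pt i ≤ c.pt i := hg i
        simp only [Pi.sub_apply] at h3
        simp only [Pi.add_apply]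
        omega
      subst hc
      rfl

/-- The vertex `0` of `Ω_{k,m}`. -/
def zero (m : Fin k → ℕ∞) : Omega m := ⟨0, fun i => by simp⟩

theorem zero_le (q : Omega m) : (zero m).pt ≤ q.pt := fun _ => Nat.zero_le _

theorem deg_eq {q p : Omega m} (f : q ⟶ p) : deg f = q.pt - p.pt := rfl

end Omega

section Boundary

variable {k : ℕ} (Λ : Type u) [Category.{v} Λ] [KGraph k Λ]

/-- A graph morphism `x : Ω_{k,m} → Λ`, that is, a degree-preserving functor, for some
`m = d(x)` in `(ℕ ∪ {∞}) ^ k`.  Two of them are equal when they have the same `m` and are the same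
functor. -/
structure PathMorphism where
  degree : Fin k → ℕ∞
  toFunctor : Omega degree ⥤ Λ
  deg_map : ∀ {q p : Omega degree} (f : q ⟶ p), deg (toFunctor.map f) = deg f

namespace PathMorphism

variable {Λ}

/-- `r(x) = x(0)`. -/
abbrev range (x : PathMorphism Λ) : Λ := x.toFunctor.obj (Omega.zero x.degree)

/-- `x` is a boundary path: whenever a vertex `p` of `Ω_{k,m}` satisfies
`(Ω_{k,m})^{≤ e_i}(p) = {p}`, also `Λ^{≤ e_i}(x(p)) = {x(p)}`. -/
def IsBoundary (x : PathMorphism Λ) : Prop :=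
  ∀ (p : Omega x.degree) (i : Fin k), pathsUpTo (e i) p = {⟨p, 𝟙 p⟩} →
    pathsUpTo (e i) (x.toFunctor.obj p) = {⟨x.toFunctor.obj p, 𝟙 (x.toFunctor.obj p)⟩}

variable (x : PathMorphism Λ) {a : Λ} (α : x.range ⟶ a)

/-- The degree `d(α) + d(x)` of `α x`. -/
def consDegree : Fin k → ℕ∞ := fun i => (deg α i : ℕ∞) + x.degree i

/-- The vertex `(q - d(α)) ∨ 0` of `Ω_{k,d(x)}`, for a vertex `q` of `Ω_{k,d(α)+d(x)}`. -/
def consShift (q : Omega (consDegree x α)) : Omega x.degree where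
  pt := q.pt - deg α
  le i := by
    have h := q.le i
    simp only [consDegree] at h
    simp only [Pi.sub_apply, ENat.natCast_sub]
    exact tsub_le_iff_left.mpr h

/-- The finite path `α x(0, (q - d(α)) ∨ 0)`, whose degree is `q ∨ d(α)`. -/
def consPath (q : Omega (consDegree x α)) : x.toFunctor.obj (consShift x α q) ⟶ a :=
  x.toFunctor.map (Omega.hom (Omega.zero_le (consShift x α q))) ≫ α

theorem le_deg_consPath (q : Omega (consDegree x α)) : q.pt ≤ deg (consPath x α q) := by
  have h : deg (consPath x α q) = deg α + (q.pt - deg α - 0) := by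
    unfold consPath
    rw [deg_comp, x.deg_map]
    rfl
  rw [h]
  intro i
  simp only [Pi.add_apply, Pi.sub_apply, Pi.zero_apply]
  omega

/-- The initial segment of degree `q` of the path `α x`, with its source `(α x)(q)` and
the remaining part of `α x(0, (q - d(α)) ∨ 0)`. -/
noncomputable def consSplit (q : Omega (consDegree x α)) :
    Σ c : Λ, (x.toFunctor.obj (consShift x α q) ⟶ c) × (c ⟶ a) :=
  split (consPath x α q) q.pt (le_deg_consPath x α q)

theorem deg_consSplit (q : Omega (consDegree x α)) : deg (consSplit x α q).2.2 = q.pt :=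
  deg_split _ _ _

theorem existsUnique_consMap {q p : Omega (consDegree x α)} (f : q ⟶ p) :
    ∃! g : (consSplit x α q).1 ⟶ (consSplit x α p).1,
      g ≫ (consSplit x α p).2.2 = (consSplit x α q).2.2 := by
  have hf : p.pt ≤ q.pt := f.down
  let s : consShift x α q ⟶ consShift x α p := Omega.hom (tsub_le_tsub_right hf (deg α))
  refine existsUnique_lift (g := (consSplit x α q).2.1)
    (g' := x.toFunctor.map s ≫ (consSplit x α p).2.1) ?_ ?_
  · have h1 : (consSplit x α q).2.1 ≫ (consSplit x α q).2.2 = consPath x α q := split_comp _ _ _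
    have h2 : (consSplit x α p).2.1 ≫ (consSplit x α p).2.2 = consPath x α p := split_comp _ _ _
    have h3 : x.toFunctor.map (Omega.hom (Omega.zero_le (consShift x α q))) =
        x.toFunctor.map s ≫ x.toFunctor.map (Omega.hom (Omega.zero_le (consShift x α p))) := by
      rw [← Functor.map_comp]
      rfl
    rw [h1, Category.assoc, h2, consPath, consPath, h3, Category.assoc]
  · rw [deg_consSplit, deg_consSplit]
    exact hf

/-- The path `(α x)(p, q)` with `(α x)(0, p) (α x)(p, q) = (α x)(0, q)`. -/
noncomputable def consMap {q p : Omega (consDegree x α)} (f : q ⟶ p) :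
    (consSplit x α q).1 ⟶ (consSplit x α p).1 :=
  (existsUnique_consMap x α f).choose

theorem consMap_comp {q p : Omega (consDegree x α)} (f : q ⟶ p) :
    consMap x α f ≫ (consSplit x α p).2.2 = (consSplit x α q).2.2 :=
  (existsUnique_consMap x α f).choose_spec.1

theorem consMap_unique {q p : Omega (consDegree x α)} (f : q ⟶ p)
    (g : (consSplit x α q).1 ⟶ (consSplit x α p).1)
    (hg : g ≫ (consSplit x α p).2.2 = (consSplit x α q).2.2) : consMap x α f = g :=
  ((existsUnique_consMap x α f).choose_spec.2 g hg).symm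

/-- The path `α x`, for `α ∈ Λ` with `s(α) = r(x)`: the graph morphism of degree `d(α) + d(x)`
for which `(α x)(0, q)` is the initial segment of degree `q` of `α x(0, (q - d(α)) ∨ 0)`, and
`(α x)(p, q)` is the path with `(α x)(0, p) (α x)(p, q) = (α x)(0, q)`. -/
noncomputable def cons : PathMorphism Λ where
  degree := consDegree x α
  toFunctor :=
    { obj := fun q => (consSplit x α q).1
      map := fun f => consMap x α f
      map_id := fun q => consMap_unique x α (𝟙 q) _ (Category.id_comp _)
      map_comp := fun f g => consMap_unique x α (f ≫ g) _ (by
        rw [Category.assoc, consMap_comp, consMap_comp]) }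
  deg_map := fun {q p} f => by
    have h := congrArg deg (consMap_comp x α f)
    rw [deg_comp, deg_consSplit, deg_consSplit] at h
    rw [Omega.deg_eq, ← h]
    exact (add_tsub_cancel_left _ _).symm

end PathMorphism

/-- Condition (B): for each vertex `v` there is a boundary path `x` with range `v` such that
`α x ≠ β x` for all distinct paths `α`, `β` with source `v`. -/
def ConditionB : Prop :=
  ∀ v : Λ, ∃ x : PathMorphism Λ, x.IsBoundary ∧ x.range = v ∧
    ∀ (a b : Λ) (α : x.range ⟶ a) (β : x.range ⟶ b),
      (⟨a, α⟩ : Σ c : Λ, x.range ⟶ c) ≠ ⟨b, β⟩ → x.cons α ≠ x.cons β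

end Boundary

section CStar

variable {k : ℕ} {Λ : Type u} [Category.{v} Λ] [KGraph k Λ] [RowFinite Λ]

/-- `t` is a Cuntz-Krieger `Λ`-family in the C⋆-algebra `B`.  The projection at the vertex `v` is
`t (𝟙 v)`. -/
structure IsCKFamily {B : Type w} [NonUnitalCStarAlgebra B]
    (t : ∀ ⦃a b : Λ⦄, (a ⟶ b) → B) : Prop where
  partialIsometry : ∀ {a b : Λ} (l : a ⟶ b), t l * star (t l) * t l = t l
  isStarProjection : ∀ v : Λ, IsStarProjection (t (𝟙 v))
  orthogonal : ∀ v v' : Λ, v ≠ v' → t (𝟙 v) * t (𝟙 v') = 0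
  map_comp : ∀ {a b c : Λ} (μ : a ⟶ b) (l : b ⟶ c), t (μ ≫ l) = t l * t μ
  star_mul_self : ∀ {a b : Λ} (l : a ⟶ b), star (t l) * t l = t (𝟙 a)
  sum_eq : ∀ (v : Λ) (m : Fin k → ℕ),
    t (𝟙 v) = ∑ l ∈ (finite_pathsUpTo m v).toFinset, t l.2 * star (t l.2)

theorem IsCKFamily.norm_le_one {B : Type w} [NonUnitalCStarAlgebra B]
    {t : ∀ ⦃a b : Λ⦄, (a ⟶ b) → B} (ht : IsCKFamily t) {a b : Λ} (l : a ⟶ b) : ‖t l‖ ≤ 1 := by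
  have hp : ‖t (𝟙 a)‖ ≤ 1 := by
    have h := CStarRing.norm_star_mul_self (x := t (𝟙 a))
    rw [(ht.isStarProjection a).isSelfAdjoint.star_eq,
      (ht.isStarProjection a).isIdempotentElem.eq] at h
    by_contra hc
    push Not at hc
    nlinarith
  have h := CStarRing.norm_star_mul_self (x := t l)
  rw [ht.star_mul_self] at h
  nlinarith [norm_nonneg (t l)]

variable (Λ) in
/-- A C⋆-algebra together with a Cuntz-Krieger `Λ`-family in it. -/
structure CKPair where
  B : Type w
  [str : NonUnitalCStarAlgebra B]
  t : ∀ ⦃a b : Λ⦄, (a ⟶ b) → B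
  isCKFamily : IsCKFamily t

attribute [instance] CKPair.str

/-- The generator at the path `l` in the bounded product over all Cuntz-Krieger `Λ`-families. -/
def genProd {a b : Λ} (l : a ⟶ b) : lp (fun P : CKPair.{u, v, w} Λ => P.B) ∞ :=
  ⟨fun P => P.t l, memℓp_infty ⟨1, by
    rintro _ ⟨P, rfl⟩
    exact P.isCKFamily.norm_le_one l⟩⟩

variable (Λ) in
/-- The closed ⋆-subalgebra generated by the `genProd l` in the bounded product over all
Cuntz-Krieger `Λ`-families (in C⋆-algebras in `Type w`). -/
noncomputable def cstarSubalgebra :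
    NonUnitalStarSubalgebra ℂ (lp (fun P : CKPair.{u, v, w} Λ => P.B) ∞) :=
  (NonUnitalStarAlgebra.adjoin ℂ
    {y | ∃ (a b : Λ) (l : a ⟶ b), y = genProd.{u, v, w} l}).topologicalClosure

instance : IsClosed (cstarSubalgebra.{u, v, w} Λ :
    Set (lp (fun P : CKPair.{u, v, w} Λ => P.B) ∞)) :=
  NonUnitalStarSubalgebra.isClosed_topologicalClosure _

variable (Λ) in
/-- The C⋆-algebra `C⋆(Λ)` of the `k`-graph: the C⋆-algebra generated by a universal
Cuntz-Krieger `Λ`-family `gen`.  That `gen` is a Cuntz-Krieger family, and universal, is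
`isCKFamily_gen` and `existsUnique_hom` below. -/
abbrev CStar : Type (max u v (w + 1)) := cstarSubalgebra.{u, v, w} Λ

noncomputable instance : NonUnitalCStarAlgebra (CStar.{u, v, w} Λ) :=
  NonUnitalStarSubalgebra.nonUnitalCStarAlgebra _

/-- The universal Cuntz-Krieger family `s` of `C⋆(Λ)`. -/
def gen ⦃a b : Λ⦄ (l : a ⟶ b) : CStar.{u, v, w} Λ :=
  ⟨genProd l, NonUnitalStarSubalgebra.le_topologicalClosure _
    (NonUnitalStarAlgebra.subset_adjoin ℂ _ ⟨a, b, l, rfl⟩)⟩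

/-- The coordinate projection of `C⋆(Λ)` at a Cuntz-Krieger family. -/
def coord (P : CKPair.{u, v, w} Λ) : CStar.{u, v, w} Λ →⋆ₙₐ[ℂ] P.B where
  toFun y := y.1 P
  map_smul' _ _ := rfl
  map_zero' := rfl
  map_add' _ _ := rfl
  map_mul' _ _ := rfl
  map_star' _ := rfl

theorem ext_coord {y z : CStar.{u, v, w} Λ} (h : ∀ P, coord P y = coord P z) : y = z :=
  Subtype.ext (lp.ext (funext h))

theorem isCKFamily_gen : IsCKFamily (gen.{u, v, w} (Λ := Λ)) where
  partialIsometry l := ext_coord fun P => by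
    simp only [map_mul, map_star]
    exact P.isCKFamily.partialIsometry l
  isStarProjection v :=
    ⟨ext_coord fun P => by
      rw [map_mul]
      exact (P.isCKFamily.isStarProjection v).isIdempotentElem,
    ext_coord fun P => by
      rw [map_star]
      exact (P.isCKFamily.isStarProjection v).isSelfAdjoint⟩
  orthogonal v v' h := ext_coord fun P => by
    rw [map_mul, map_zero]
    exact P.isCKFamily.orthogonal v v' h
  map_comp μ l := ext_coord fun P => by
    rw [map_mul]
    exact P.isCKFamily.map_comp μ l
  star_mul_self l := ext_coord fun P => by
    rw [map_mul, map_star]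
    exact P.isCKFamily.star_mul_self l
  sum_eq v m := ext_coord fun P => by
    simp only [map_sum, map_mul, map_star]
    exact P.isCKFamily.sum_eq v m

/-- The universal property of `C⋆(Λ)`. -/
theorem existsUnique_hom {B : Type w} [NonUnitalCStarAlgebra B]
    {t : ∀ ⦃a b : Λ⦄, (a ⟶ b) → B} (ht : IsCKFamily t) :
    ∃! π : CStar.{u, v, w} Λ →⋆ₙₐ[ℂ] B, ∀ (a b : Λ) (l : a ⟶ b), π (gen l) = t l := by
  refine ⟨coord ⟨B, t, ht⟩, fun _ _ _ => rfl, fun π hπ => ?_⟩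
  let ρ : CStar.{u, v, w} Λ →⋆ₙₐ[ℂ] B := coord ⟨B, t, ht⟩
  have hc : ∀ φ : CStar.{u, v, w} Λ →⋆ₙₐ[ℂ] B, Continuous φ := fun φ =>
    AddMonoidHomClass.continuous_of_bound φ 1 fun y => by
      rw [one_mul]
      exact NonUnitalStarAlgHom.norm_apply_le φ y
  have hE : NonUnitalStarSubalgebra.map (NonUnitalStarSubalgebraClass.subtype
      (cstarSubalgebra.{u, v, w} Λ)) (NonUnitalStarAlgHom.equalizer π ρ) =
      cstarSubalgebra.{u, v, w} Λ := by
    refine le_antisymm ?_ ?_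
    · rintro _ ⟨y, -, rfl⟩
      exact y.2
    · refine NonUnitalStarSubalgebra.topologicalClosure_minimal _
        (NonUnitalStarAlgebra.adjoin_le ?_) ?_
      · rintro _ ⟨a, b, l, rfl⟩
        exact ⟨gen l, hπ a b l, rfl⟩
      · have h1 : IsClosed {y : CStar.{u, v, w} Λ | π y = ρ y} :=
          isClosed_eq (hc π) (hc ρ)
        have h2 : IsClosed (cstarSubalgebra.{u, v, w} Λ :
            Set (lp (fun P : CKPair.{u, v, w} Λ => P.B) ∞)) := inferInstance
        exact h2.isClosedEmbedding_subtypeVal.isClosedMap _ h1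
  refine NonUnitalStarAlgHom.ext fun y => ?_
  obtain ⟨z, hz, hzy⟩ : (y : lp (fun P : CKPair.{u, v, w} Λ => P.B) ∞) ∈
      NonUnitalStarSubalgebra.map (NonUnitalStarSubalgebraClass.subtype
        (cstarSubalgebra.{u, v, w} Λ)) (NonUnitalStarAlgHom.equalizer π ρ) := by
    rw [hE]
    exact y.2
  have : z = y := Subtype.ext hzy
  subst this
  exact hz

end CStar

end KGraph

/-! In each coordinate `P` of `C⋆(Λ)`, let `Φ(y)` be the average over the torus of the gauge twists
`gaugeCoord P z y`. On a finite sum of products `s_λ s_μ⋆`, averaging keeps exactly the terms with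
`d(λ) = d(μ)`. Everything rests on the inequality `‖Φ(y)‖ ≤ ‖π(y)‖`. If `π(y) = 0`, then it gives
`Φ(y⋆y) = 0`; the integrand is continuous and positive, so it vanishes everywhere, in particular at
the identity of the torus, and `y = 0` in every coordinate.

By density it suffices to take a finite sum `A = ∑ c_j t_λ t_μ⋆` (`norm_core_le`). Fix `q` above all
degrees that occur. Relation (4) rewrites the part with `d(λ) = d(μ)` as `∑ C_{p,p'} t_p t_{p'}⋆`
with `p, p' ∈ Λ^{≤q}`, where `C` links only paths of equal degree and equal source. Distinct `t_p`
have orthogonal ranges, so in any family the norm of this part is at most the norm of the matrix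
`C`, hence of its largest block.

It remains to bound the block of degree `n` and source `v` by `‖A‖`. Take the path `x` from
condition (B) at `v` and compress `A` by `W(ζ) = ∑ ζ_p t_p t_{x(0,M)}`. A term with `d(λ) ≠ d(μ)`
contributes multiples of compressions of `t_α⋆ t_β` with `α ≠ β`; since `α x ≠ β x`, these vanish
for large `M`. What is left is `W(ζ)⋆ A W(η) = ⟨ζ, C η⟩ t_{x(M)}`. As `t_{x(M)} ≠ 0`, one has
`‖W(ζ)‖ = ‖ζ‖`, and so `|⟨ζ, C η⟩| ≤ ‖A‖ ‖ζ‖ ‖η‖`. -/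

/-! ### Block matrices -/

open Matrix ComplexOrder in
/-- A block matrix whose blocks are bounded by `K` as sesquilinear forms is bounded by `K`. -/
theorem Matrix.posSemidef_sub_mul_conjTranspose_of_blocks {ι κ : Type*} [Fintype ι] [DecidableEq ι]
    (key : ι → κ) (C : Matrix ι ι ℂ) (hkey : ∀ i j, C i j ≠ 0 → key i = key j) (K : ℝ)
    (hK : ∀ (b : κ) (ζ η : ι → ℂ), (∀ i, key i ≠ b → ζ i = 0) → (∀ i, key i ≠ b → η i = 0) →
      ‖∑ i, ∑ j, star (ζ i) * C i j * η j‖ ^ 2 ≤ K ^ 2 * (∑ i, ‖ζ i‖ ^ 2) * ∑ i, ‖η i‖ ^ 2) :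
    ((((K ^ 2 : ℝ) : ℂ) • (1 : Matrix ι ι ℂ)) - C * Cᴴ).PosSemidef := by
  classical
  have herm : ((((K ^ 2 : ℝ) : ℂ) • (1 : Matrix ι ι ℂ)) - C * Cᴴ).IsHermitian := by
    refine IsHermitian.sub ?_ (isHermitian_mul_conjTranspose_self C)
    rw [IsHermitian, conjTranspose_smul, conjTranspose_one, Complex.star_def, Complex.conj_ofReal]
  refine PosSemidef.of_dotProduct_mulVec_nonneg herm fun ζ => ?_
  set θ : ι → ℂ := Cᴴ *ᵥ ζ with hθ
  have hθj : ∀ j, θ j = ∑ i, star (C i j) * ζ i := fun j => rfl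
  have hblock : ∀ b : κ, ∑ j with key j = b, ‖θ j‖ ^ 2 ≤ K ^ 2 * ∑ i with key i = b, ‖ζ i‖ ^ 2 := by
    intro b
    set A := ∑ j with key j = b, ‖θ j‖ ^ 2 with hA
    set Z := ∑ i with key i = b, ‖ζ i‖ ^ 2 with hZ
    have hA0 : 0 ≤ A := Finset.sum_nonneg fun _ _ => by positivity
    -- Testing the form on the block parts of `ζ` and of `θ = Cᴴ ζ` gives the value `A`, so the
    -- bound reads `A² ≤ K² Z A`, and `A` cancels when it is positive.
    have h := hK b (fun i => if key i = b then ζ i else 0) (fun i => if key i = b then θ i else 0)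
      (fun i hi => if_neg hi) (fun i hi => if_neg hi)
    have e1 : ∑ i, ‖(if key i = b then ζ i else 0)‖ ^ 2 = Z := by
      rw [hZ, Finset.sum_filter]
      exact Finset.sum_congr rfl fun i _ => by split_ifs <;> simp
    have e2 : ∑ i, ‖(if key i = b then θ i else 0)‖ ^ 2 = A := by
      rw [hA, Finset.sum_filter]
      exact Finset.sum_congr rfl fun i _ => by split_ifs <;> simp
    have e3 : ∑ i, ∑ j, star (if key i = b then ζ i else 0) * C i j *
        (if key j = b then θ j else 0) = (A : ℂ) := by
      rw [Finset.sum_comm, hA, Finset.sum_filter, Complex.ofReal_sum]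
      refine Finset.sum_congr rfl fun j _ => ?_
      split_ifs with hj
      · rw [← Finset.sum_mul]
        have : ∑ i, star (if key i = b then ζ i else 0) * C i j = star (θ j) := by
          rw [hθj, star_sum]
          refine Finset.sum_congr rfl fun i _ => ?_
          rw [star_mul', star_star, mul_comm (C i j)]
          split_ifs with hi
          · rfl
          · have : C i j = 0 := by
              by_contra hc
              exact hi ((hkey i j hc).trans hj)
            simp [this]
        rw [this, Complex.star_def, mul_comm, Complex.mul_conj, Complex.normSq_eq_norm_sq]
      · simp
    rw [e1, e2, e3, Complex.norm_real, Real.norm_of_nonneg hA0] at h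
    rcases hA0.eq_or_lt with h0 | h0
    · rw [← h0]
      exact mul_nonneg (sq_nonneg _) (Finset.sum_nonneg fun _ _ => by positivity)
    · exact le_of_mul_le_mul_right (by rw [← sq]; exact h) h0
  have htot : ∑ j, ‖θ j‖ ^ 2 ≤ K ^ 2 * ∑ i, ‖ζ i‖ ^ 2 := by
    rw [← Finset.sum_fiberwise_of_maps_to (s := Finset.univ) (t := Finset.univ.image key) (g := key)
      (fun i _ => Finset.mem_image_of_mem _ (Finset.mem_univ i)) (fun j => ‖θ j‖ ^ 2),
      ← Finset.sum_fiberwise_of_maps_to (s := Finset.univ) (t := Finset.univ.image key) (g := key)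
      (fun i _ => Finset.mem_image_of_mem _ (Finset.mem_univ i)) (fun j => ‖ζ j‖ ^ 2),
      Finset.mul_sum]
    exact Finset.sum_le_sum fun b _ => hblock b
  have hdot : ∀ f : ι → ℂ, star f ⬝ᵥ f = ((∑ i, ‖f i‖ ^ 2 : ℝ) : ℂ) := by
    intro f
    rw [dotProduct, Complex.ofReal_sum]
    refine Finset.sum_congr rfl fun i _ => ?_
    rw [Pi.star_apply, Complex.star_def, mul_comm, Complex.mul_conj, Complex.normSq_eq_norm_sq]
  have key2 : star ζ ⬝ᵥ ((C * Cᴴ) *ᵥ ζ) = star θ ⬝ᵥ θ := by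
    rw [← mulVec_mulVec, dotProduct_mulVec, hθ, star_mulVec, conjTranspose_conjTranspose]
  rw [sub_mulVec, dotProduct_sub, smul_mulVec, one_mulVec, dotProduct_smul, key2, hdot, hdot,
    smul_eq_mul, ← Complex.ofReal_mul, ← Complex.ofReal_sub]
  exact_mod_cast sub_nonneg.mpr htot

open Matrix ComplexOrder MatrixOrder in
theorem Matrix.PosSemidef.exists_eq_conjTranspose_mul {ι : Type*} [Fintype ι] [DecidableEq ι]
    {M : Matrix ι ι ℂ} (hM : M.PosSemidef) : ∃ D : Matrix ι ι ℂ, M = Dᴴ * D :=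
  CStarAlgebra.nonneg_iff_eq_star_mul_self.mp hM.nonneg

/-! ### Projections, norm bounds and faithful integrals in C⋆-algebras -/

section CStarLemmas

variable {B : Type*} [NonUnitalCStarAlgebra B]

/-- If finitely many projections add up to a projection, they are mutually orthogonal. -/
theorem IsStarProjection.mul_eq_zero_of_sum {ι : Type*} {s : Finset ι} {p : ι → B}
    (hp : ∀ i ∈ s, IsStarProjection (p i)) {e : B} (he : e = ∑ i ∈ s, p i)
    (hep : ∀ i ∈ s, e * p i = p i) {i j : ι} (hi : i ∈ s) (hj : j ∈ s) (hij : i ≠ j) :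
    p i * p j = 0 := by
  classical
  let _ := CStarAlgebra.spectralOrder B
  let _ := CStarAlgebra.spectralOrderedRing B
  have h1 : p i * e * p i = p i := by
    rw [mul_assoc, hep i hi, (hp i hi).isIdempotentElem.eq]
  have hterm : ∀ l ∈ s, p i * p l * p i = star (p l * p i) * (p l * p i) := by
    intro l hl
    rw [star_mul, (hp i hi).isSelfAdjoint.star_eq, (hp l hl).isSelfAdjoint.star_eq,
      mul_assoc (p i) (p l) (p l * p i), ← mul_assoc (p l) (p l),
      (hp l hl).isIdempotentElem.eq, mul_assoc]
  -- Compressing `e = ∑ p_l` by `p_i` returns `p_i`, which the term `l = i` already accounts for.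
  -- The other terms are positive with sum zero, so each vanishes.
  have h2 : ∑ l ∈ s.erase i, p i * p l * p i = 0 := by
    rw [he, Finset.mul_sum, Finset.sum_mul, ← Finset.add_sum_erase _ _ hi,
      (hp i hi).isIdempotentElem.eq, (hp i hi).isIdempotentElem.eq] at h1
    exact left_eq_add.mp h1.symm
  have h3 := (Finset.sum_eq_zero_iff_of_nonneg (fun l hl => by
    rw [hterm l (Finset.mem_of_mem_erase hl)]
    exact star_mul_self_nonneg _)).mp h2 j (Finset.mem_erase.mpr ⟨hij.symm, hj⟩)
  rw [hterm j hj, CStarRing.star_mul_self_eq_zero_iff] at h3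
  have h4 := congrArg star h3
  rwa [star_mul, star_zero, (hp i hi).isSelfAdjoint.star_eq,
    (hp j hj).isSelfAdjoint.star_eq] at h4

-- Orthogonality of the ranges gives `b b⋆ = ∑ (C Cᴴ)_{im} T_i T_m⋆`, as in a matrix algebra.
-- Factoring `K² - C Cᴴ = Dᴴ D` exhibits `K² P - b b⋆` as a sum of squares, where `P = ∑ T_i T_i⋆`
-- is a projection; hence `‖b‖² ≤ K²`. The initial projections `Q_i` may differ, and `hC` ensures
-- that a nonzero coefficient never meets two different ones.
open Matrix ComplexOrder in
theorem norm_sum_smul_mul_star_le {ι : Type*} [Fintype ι] [DecidableEq ι] {T Q : ι → B}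
    (horth : ∀ i j, i ≠ j → star (T i) * T j = 0) (hQ : ∀ i, star (T i) * T i = Q i)
    (hTQ : ∀ i, T i * Q i = T i) {C : Matrix ι ι ℂ} (hC : ∀ i j, C i j ≠ 0 → Q i = Q j)
    {K : ℝ} (hK : 0 ≤ K)
    (hpsd : ((((K ^ 2 : ℝ) : ℂ) • (1 : Matrix ι ι ℂ)) - C * Cᴴ).PosSemidef) :
    ‖∑ i, ∑ j, C i j • (T i * star (T j))‖ ≤ K := by
  let _ := CStarAlgebra.spectralOrder B
  let _ := CStarAlgebra.spectralOrderedRing B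
  set b := ∑ i, ∑ j, C i j • (T i * star (T j)) with hb
  set P := ∑ i, T i * star (T i) with hP
  have hmul : ∀ i j l m, (T i * star (T j)) * (T l * star (T m)) =
      if j = l then T i * Q j * star (T m) else 0 := by
    intro i j l m
    rw [mul_assoc, ← mul_assoc (star (T j))]
    split_ifs with h
    · subst h
      rw [hQ, mul_assoc]
    · rw [horth j l h, zero_mul, mul_zero]
  have hPproj : IsStarProjection P := by
    constructor
    · rw [IsIdempotentElem, hP, Finset.sum_mul_sum]
      refine Finset.sum_congr rfl fun i _ => ?_
      simp_rw [hmul, hTQ]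
      simp
    · rw [IsSelfAdjoint, hP, star_sum]
      exact Finset.sum_congr rfl fun i _ => by rw [star_mul, star_star]
  have hbstar : star b = ∑ j, ∑ i, star (C i j) • (T j * star (T i)) := by
    rw [hb, star_sum]
    simp_rw [star_sum, star_smul, star_mul, star_star]
    exact Finset.sum_comm
  have hbb : b * star b = ∑ i, ∑ m, (C * Cᴴ) i m • (T i * star (T m)) := by
    rw [hbstar, hb, Finset.sum_mul]
    refine Finset.sum_congr rfl fun i _ => ?_
    rw [Finset.sum_mul_sum]
    simp_rw [Finset.mul_sum, smul_mul_smul_comm, hmul]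
    have : ∀ j l, (∑ m, (C i j * star (C m l)) • (if j = l then T i * Q j * star (T m) else 0)) =
        if j = l then ∑ m, (C i j * star (C m j)) • (T i * star (T m)) else 0 := by
      intro j l
      split_ifs with h
      · subst h
        refine Finset.sum_congr rfl fun m _ => ?_
        by_cases hz : C i j = 0
        · simp [hz]
        · rw [← hC i j hz, hTQ]
      · simp
    simp_rw [this]
    simp only [Finset.sum_ite_eq, Finset.mem_univ, if_true]
    rw [Finset.sum_comm]
    refine Finset.sum_congr rfl fun m _ => ?_
    rw [← Finset.sum_smul]
    rfl
  obtain ⟨D, hD⟩ := hpsd.exists_eq_conjTranspose_mul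
  have hle : b * star b ≤ ((K ^ 2 : ℝ) : ℂ) • P := by
    rw [← sub_nonneg]
    have : ((K ^ 2 : ℝ) : ℂ) • P - b * star b =
        ∑ r, (∑ i, star (D r i) • T i) * star (∑ i, star (D r i) • T i) := by
      have h1 : ((K ^ 2 : ℝ) : ℂ) • P = ∑ i, ∑ m,
          ((((K ^ 2 : ℝ) : ℂ) • (1 : Matrix ι ι ℂ)) i m) • (T i * star (T m)) := by
        rw [hP, Finset.smul_sum]
        refine Finset.sum_congr rfl fun i _ => ?_
        simp [Matrix.one_apply]
      rw [h1, hbb, ← Finset.sum_sub_distrib]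
      simp_rw [← Finset.sum_sub_distrib, ← sub_smul, ← Matrix.sub_apply, hD]
      simp_rw [star_sum, Finset.sum_mul_sum, star_smul, star_star, smul_mul_smul_comm]
      conv_rhs => rw [Finset.sum_comm]
      refine Finset.sum_congr rfl fun i _ => ?_
      conv_rhs => rw [Finset.sum_comm]
      refine Finset.sum_congr rfl fun m _ => ?_
      rw [← Finset.sum_smul]
      rfl
    rw [this]
    exact Finset.sum_nonneg fun r _ => mul_star_self_nonneg _
  have h1 := CStarAlgebra.norm_le_norm_of_nonneg_of_le (mul_star_self_nonneg b) hle
  rw [CStarRing.norm_self_mul_star, norm_smul, Complex.norm_real,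
    Real.norm_of_nonneg (sq_nonneg K)] at h1
  have h2 : ‖P‖ ≤ 1 := hPproj.norm_le
  have h3 : ‖b‖ ^ 2 ≤ K ^ 2 := by nlinarith [sq_nonneg K]
  exact abs_le_of_sq_le_sq' h3 hK |>.2

theorem IsStarProjection.norm_eq_one {p : B} (hp : IsStarProjection p) (h0 : p ≠ 0) :
    ‖p‖ = 1 := by
  have h := CStarRing.norm_star_mul_self (x := p)
  rw [hp.isSelfAdjoint.star_eq, hp.isIdempotentElem.eq] at h
  have : ‖p‖ ≠ 0 := norm_ne_zero_iff.mpr h0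
  exact (mul_right_cancel₀ this (by rw [one_mul]; exact h)).symm

open MeasureTheory in
/-- The integral of a continuous positive function determines whether it vanishes. -/
theorem eq_zero_of_integral_star_mul_self_eq_zero {X : Type*} [TopologicalSpace X] [CompactSpace X]
    [SecondCountableTopology X] [MeasurableSpace X] [BorelSpace X] (μ : Measure X)
    [IsFiniteMeasure μ] [μ.IsOpenPosMeasure] {f : X → B} (hf : Continuous f)
    (h : ∫ z, star (f z) * f z ∂μ = 0) (z₀ : X) : f z₀ = 0 := by
  let _ := CStarAlgebra.spectralOrder B
  let _ := CStarAlgebra.spectralOrderedRing B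
  set g : X → B := fun z => star (f z) * f z with hg
  have hgc : Continuous g := hf.star.mul hf
  have hg0 : 0 ≤ g := fun z => star_mul_self_nonneg _
  have hint : Integrable g μ := hgc.integrable_of_hasCompactSupport (.of_compactSpace g)
  suffices hz : g z₀ = 0 from CStarRing.star_mul_self_eq_zero_iff _ |>.mp hz
  rw [← norm_le_zero_iff]
  refine le_of_forall_pos_le_add fun ε hε => ?_
  rw [zero_add]
  -- On `U` the function `g` is within `ε` of `g z₀`, while its integral over `U` vanishes by
  -- positivity. Thus `‖g z₀‖ μ(U) ≤ ε μ(U)`, and `μ(U) > 0`.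
  set U : Set X := {z | ‖g z - g z₀‖ < ε} with hU
  have hUo : IsOpen U := isOpen_lt (hgc.sub continuous_const).norm continuous_const
  have hUpos : 0 < μ.real U := by
    rw [measureReal_def]
    exact ENNReal.toReal_pos (hUo.measure_pos μ ⟨z₀, by simpa [hU] using hε⟩).ne'
      (measure_ne_top μ U)
  have hU0 : ∫ z in U, g z ∂μ = 0 := by
    have h1 := integral_add_compl hUo.measurableSet hint
    rw [h] at h1
    have h2 : 0 ≤ ∫ z in U, g z ∂μ := integral_nonneg hg0
    have h3 : 0 ≤ ∫ z in Uᶜ, g z ∂μ := integral_nonneg hg0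
    exact ((add_eq_zero_iff_of_nonneg h2 h3).mp h1).1
  have h4 : ‖∫ z in U, (g z - g z₀) ∂μ‖ ≤ ε * μ.real U :=
    norm_setIntegral_le_of_norm_le_const (measure_lt_top μ U) fun z hz => le_of_lt hz
  rw [integral_sub hint.integrableOn (integrable_const _), hU0, setIntegral_const, zero_sub,
    norm_neg, norm_smul, Real.norm_of_nonneg hUpos.le, mul_comm] at h4
  exact le_of_mul_le_mul_right h4 hUpos

end CStarLemmas

/-! ### Paths at a common level `q` and products in a Cuntz–Krieger family -/

namespace KGraph

/-- A path of `Λ` together with its source and its range. -/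
structure Mor (Λ : Type u) [Category.{v} Λ] where
  src : Λ
  tgt : Λ
  hom : src ⟶ tgt

section Paths

variable {k : ℕ} {Λ : Type u} [Category.{v} Λ] [KGraph k Λ]

namespace Mor

/-- The path `p α`. -/
def extend (p : Mor Λ) {c : Λ} (α : c ⟶ p.src) : Mor Λ := ⟨c, p.tgt, α ≫ p.hom⟩

/-- `p` belongs to `Λ^{≤ q}`. -/
def IsUpTo (q : Fin k → ℕ) (p : Mor Λ) : Prop :=
  (⟨p.src, p.hom⟩ : Σ a : Λ, a ⟶ p.tgt) ∈ pathsUpTo q p.tgt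

/-- The emptiness conditions agree because `d(pα) + e_i ≤ q` amounts to `d(α) + e_i ≤ q - d(p)`.
This lets relation (4) raise every path of degree at most `q` to the level `q`. -/
theorem isUpTo_extend {p : Mor Λ} {q : Fin k → ℕ} (hp : deg p.hom ≤ q)
    {α : Σ a : Λ, a ⟶ p.src} (hα : α ∈ pathsUpTo (q - deg p.hom) p.src) :
    (p.extend α.2).IsUpTo q := by
  have hdeg : deg (α.2 ≫ p.hom) = deg p.hom + deg α.2 := deg_comp _ _
  refine ⟨?_, fun i hi => hα.2 i ?_⟩
  · change deg (α.2 ≫ p.hom) ≤ q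
    rw [hdeg, ← add_tsub_cancel_of_le hp]
    exact add_le_add_right hα.1 _
  · change deg (α.2 ≫ p.hom) + e i ≤ q at hi
    rw [hdeg, add_assoc, add_comm] at hi
    exact le_tsub_of_add_le_right hi

end Mor

/-- If `x` receives no edge of colour `i`, no path with range `x` has a positive degree in the
direction `i`. -/
theorem deg_apply_eq_zero {x y : Λ} {i : Fin k} (hx : paths (e i) x = ∅) (γ : y ⟶ x) :
    deg γ i = 0 := by
  by_contra h
  have hle : e i ≤ deg γ := by
    intro j
    by_cases hj : j = i
    · subst hj
      simp only [e, Pi.single_eq_same]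
      omega
    · simp [e, hj]
  have : (⟨(split γ (e i) hle).1, (split γ (e i) hle).2.2⟩ : Σ a : Λ, a ⟶ x) ∈ paths (e i) x :=
    deg_split γ (e i) hle
  rw [hx] at this
  exact this

end Paths

section Family

variable {k : ℕ} {Λ : Type u} [Category.{v} Λ] [KGraph k Λ] [RowFinite Λ]
  {B : Type w} [NonUnitalCStarAlgebra B] {t : ∀ ⦃a b : Λ⦄, (a ⟶ b) → B}

namespace IsCKFamily

theorem mul_id (ht : IsCKFamily t) {a b : Λ} (l : a ⟶ b) : t l * t (𝟙 a) = t l := by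
  rw [← ht.map_comp, Category.id_comp]

theorem id_mul (ht : IsCKFamily t) {a b : Λ} (l : a ⟶ b) : t (𝟙 b) * t l = t l := by
  rw [← ht.map_comp, Category.comp_id]

theorem star_mul_comp (ht : IsCKFamily t) {a b c : Λ} (α : a ⟶ b) (l : b ⟶ c) :
    star (t l) * t (α ≫ l) = t α := by
  rw [ht.map_comp, ← mul_assoc, ht.star_mul_self, ht.id_mul]

theorem star_comp_mul (ht : IsCKFamily t) {a b c : Λ} (α : a ⟶ b) (l : b ⟶ c) :
    star (t (α ≫ l)) * t l = star (t α) := by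
  rw [← star_inj, star_mul, star_star, star_star, ht.star_mul_comp]

theorem star_mul_mul_star (ht : IsCKFamily t) {a b : Λ} (l : a ⟶ b) :
    star (t l) * t l * star (t l) = star (t l) := by
  rw [← star_inj, star_mul, star_mul, star_star, ← mul_assoc, ht.partialIsometry]

theorem isStarProjection_mul_star (ht : IsCKFamily t) {a b : Λ} (l : a ⟶ b) :
    IsStarProjection (t l * star (t l)) :=
  ⟨by rw [IsIdempotentElem, ← mul_assoc, ht.partialIsometry],
    by rw [IsSelfAdjoint, star_mul, star_star]⟩

theorem star_mul_eq_zero_of_tgt_ne (ht : IsCKFamily t) {a b a' b' : Λ} (l : a ⟶ b) (l' : a' ⟶ b')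
    (h : b ≠ b') : star (t l) * t l' = 0 := by
  rw [← ht.id_mul l, ← ht.id_mul l', star_mul, (ht.isStarProjection b).isSelfAdjoint.star_eq,
    mul_assoc, ← mul_assoc (t (𝟙 b)), ht.orthogonal b b' h, zero_mul, mul_zero]

/-- Distinct paths in `Λ^{≤ q}` have orthogonal ranges. -/
theorem star_mul_eq_zero (ht : IsCKFamily t) {q : Fin k → ℕ} {p p' : Mor Λ} (hp : p.IsUpTo q)
    (hp' : p'.IsUpTo q) (hne : p ≠ p') : star (t p.hom) * t p'.hom = 0 := by
  obtain ⟨a, b, l⟩ := p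
  obtain ⟨a', b', l'⟩ := p'
  by_cases hb : b = b'
  · subst hb
    have hne' : (⟨a, l⟩ : Σ a : Λ, a ⟶ b) ≠ ⟨a', l'⟩ := by
      rintro h
      cases h
      exact hne rfl
    have h := IsStarProjection.mul_eq_zero_of_sum (s := (finite_pathsUpTo q b).toFinset)
      (p := fun l : Σ a : Λ, a ⟶ b => t l.2 * star (t l.2))
      (fun l _ => ht.isStarProjection_mul_star l.2) (ht.sum_eq b q)
      (fun l _ => by rw [← mul_assoc, ht.id_mul])
      ((finite_pathsUpTo q b).mem_toFinset.mpr hp) ((finite_pathsUpTo q b).mem_toFinset.mpr hp')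
      hne'
    change t l * star (t l) * (t l' * star (t l')) = 0 at h
    calc star (t l) * t l' = star (t l) * (t l * star (t l) * (t l' * star (t l'))) * t l' := by
          rw [mul_assoc, mul_assoc, mul_assoc, mul_assoc, ← mul_assoc (t l'), ht.partialIsometry,
            ← mul_assoc, ← mul_assoc, ht.star_mul_mul_star]
      _ = 0 := by rw [h, mul_zero, zero_mul]
  · exact ht.star_mul_eq_zero_of_tgt_ne l l' hb

theorem star_mul_eq_ite [DecidableEq (Mor Λ)] (ht : IsCKFamily t) {q : Fin k → ℕ} {p p' : Mor Λ}
    (hp : p.IsUpTo q) (hp' : p'.IsUpTo q) :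
    star (t p.hom) * t p'.hom = if p = p' then t (𝟙 p.src) else 0 := by
  split_ifs with h
  · subst h
    exact ht.star_mul_self p.hom
  · exact ht.star_mul_eq_zero hp hp' h

theorem mul_star_eq_sum (ht : IsCKFamily t) {a b c : Λ} (σ : a ⟶ b) (τ : a ⟶ c)
    (q : Fin k → ℕ) : t σ * star (t τ) =
      ∑ α ∈ (finite_pathsUpTo q a).toFinset, t (α.2 ≫ σ) * star (t (α.2 ≫ τ)) := by
  calc t σ * star (t τ) = t σ * t (𝟙 a) * star (t τ) := by rw [ht.mul_id]
    _ = _ := by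
      rw [ht.sum_eq a q, Finset.mul_sum, Finset.sum_mul]
      refine Finset.sum_congr rfl fun α _ => ?_
      rw [ht.map_comp, ht.map_comp, star_mul]
      simp only [mul_assoc]

/-- If `λ ∈ Λ^{≤ q}` and `d(σ) ≤ q`, then `t_σ⋆ t_λ` vanishes unless `λ = σ α`. -/
theorem star_mul_of_isUpTo (ht : IsCKFamily t) {q : Fin k → ℕ} {σ p : Mor Λ}
    (hσ : deg σ.hom ≤ q) (hp : p.IsUpTo q) (h0 : star (t σ.hom) * t p.hom ≠ 0) :
    ∃ α : p.src ⟶ σ.src, p = σ.extend α := by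
  by_contra hno
  push Not at hno
  refine h0 ?_
  rw [← ht.star_mul_mul_star σ.hom, mul_assoc (star _),
    ht.mul_star_eq_sum σ.hom σ.hom (q - deg σ.hom), mul_assoc, Finset.sum_mul]
  rw [Finset.sum_eq_zero, mul_zero]
  intro α hα
  rw [mul_assoc]
  change t (α.2 ≫ σ.hom) * (star (t (σ.extend α.2).hom) * t p.hom) = 0
  rw [ht.star_mul_eq_zero
    (Mor.isUpTo_extend hσ ((finite_pathsUpTo _ _).mem_toFinset.mp hα)) hp, mul_zero]
  rintro rfl
  exact hno α.2 rfl

/-- Both range projections are inserted and expanded by relation (4). For `q` above both degrees the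
middle factors compare paths of `Λ^{≤q}`, so each is zero or a vertex projection. -/
theorem star_mul_eq_sum (ht : IsCKFamily t) (σ τ : Mor Λ) (q : Fin k → ℕ) :
    star (t σ.hom) * t τ.hom =
      ∑ α ∈ (finite_pathsUpTo (q - deg σ.hom) σ.src).toFinset,
        ∑ β ∈ (finite_pathsUpTo (q - deg τ.hom) τ.src).toFinset,
          t α.2 * (star (t (σ.extend α.2).hom) * t (τ.extend β.2).hom) * star (t β.2) := by
  calc star (t σ.hom) * t τ.hom =
      star (t σ.hom) * (t σ.hom * star (t σ.hom)) * ((t τ.hom * star (t τ.hom)) * t τ.hom) := by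
        rw [ht.partialIsometry, ← mul_assoc (star _), ht.star_mul_mul_star]
    _ = _ := by
      rw [ht.mul_star_eq_sum σ.hom σ.hom (q - deg σ.hom),
        ht.mul_star_eq_sum τ.hom τ.hom (q - deg τ.hom), Finset.mul_sum,
        Finset.sum_mul _ _ (t τ.hom), Finset.sum_mul_sum]
      refine Finset.sum_congr rfl fun α _ => Finset.sum_congr rfl fun β _ => ?_
      rw [← mul_assoc (star _), ht.star_mul_comp, mul_assoc (t (β.2 ≫ τ.hom)), ht.star_comp_mul]
      simp only [Mor.extend, mul_assoc]

/-- Some term of the expansion at level `d(σ) ∨ d(τ)` is nonzero; by orthogonality its two paths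
`σγ` and `τδ` must coincide. -/
theorem exists_comp_eq_comp (ht : IsCKFamily t) {a a' b : Λ} {σ : a ⟶ b} {τ : a' ⟶ b}
    (h0 : star (t σ) * t τ ≠ 0) : ∃ (c : Λ) (γ : c ⟶ a) (δ : c ⟶ a'), γ ≫ σ = δ ≫ τ := by
  rw [ht.star_mul_eq_sum ⟨a, b, σ⟩ ⟨a', b, τ⟩ (deg σ ⊔ deg τ)] at h0
  obtain ⟨α, hα, h1⟩ := Finset.exists_ne_zero_of_sum_ne_zero h0
  obtain ⟨β, hβ, h2⟩ := Finset.exists_ne_zero_of_sum_ne_zero h1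
  have h3 : Mor.extend ⟨a, b, σ⟩ α.2 = Mor.extend ⟨a', b, τ⟩ β.2 := by
    by_contra hne
    refine h2 ?_
    rw [ht.star_mul_eq_zero
      (Mor.isUpTo_extend (le_sup_left : deg σ ≤ _) ((finite_pathsUpTo _ _).mem_toFinset.mp hα))
      (Mor.isUpTo_extend (le_sup_right : deg τ ≤ _) ((finite_pathsUpTo _ _).mem_toFinset.mp hβ))
      hne, mul_zero, zero_mul]
  obtain ⟨c, α⟩ := α
  obtain ⟨c', β⟩ := β
  simp only [Mor.extend, Mor.mk.injEq] at h3
  obtain ⟨rfl, -, h4⟩ := h3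
  exact ⟨c, α, β, eq_of_heq h4⟩

end IsCKFamily

/-- The index set of the products `t_λ t_μ⋆` with `s(λ) = s(μ)`. -/
structure Span (Λ : Type u) [Category.{v} Λ] where
  src : Λ
  tgt₁ : Λ
  tgt₂ : Λ
  hom₁ : src ⟶ tgt₁
  hom₂ : src ⟶ tgt₂

/-- The product `t_λ t_μ⋆`. -/
def Span.eval (t : ∀ ⦃a b : Λ⦄, (a ⟶ b) → B) (j : Span Λ) : B := t j.hom₁ * star (t j.hom₂)

theorem IsCKFamily.eval_mul_eval_mem (ht : IsCKFamily t) (j j' : Span Λ) :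
    j.eval t * j'.eval t ∈ Submodule.span ℂ (Set.range (Span.eval t)) := by
  classical
  have h := ht.star_mul_eq_sum ⟨_, _, j.hom₂⟩ ⟨_, _, j'.hom₁⟩ (deg j.hom₂ ⊔ deg j'.hom₁)
  have h1 : j.eval t * j'.eval t =
      t j.hom₁ * (star (t j.hom₂) * t j'.hom₁) * star (t j'.hom₂) := by
    simp only [Span.eval, mul_assoc]
  rw [h1, h, Finset.mul_sum, Finset.sum_mul]
  refine Submodule.sum_mem _ fun α hα => ?_
  rw [Finset.mul_sum, Finset.sum_mul]
  refine Submodule.sum_mem _ fun β hβ => ?_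
  rw [ht.star_mul_eq_ite
      (Mor.isUpTo_extend (p := ⟨_, _, j.hom₂⟩) (le_sup_left : deg j.hom₂ ≤ _)
        ((finite_pathsUpTo _ _).mem_toFinset.mp hα))
      (Mor.isUpTo_extend (p := ⟨_, _, j'.hom₁⟩) (le_sup_right : deg j'.hom₁ ≤ _)
        ((finite_pathsUpTo _ _).mem_toFinset.mp hβ))]
  split_ifs with h3
  · obtain ⟨c, α⟩ := α
    obtain ⟨c', β⟩ := β
    simp only [Mor.extend, Mor.mk.injEq] at h3
    obtain ⟨rfl, -, -⟩ := h3
    refine Submodule.subset_span ⟨⟨c, _, _, α ≫ j.hom₁, β ≫ j'.hom₂⟩, ?_⟩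
    simp only [Span.eval, Mor.extend, ht.map_comp, star_mul, mul_assoc]
    rw [← mul_assoc (t (𝟙 c)), ← (ht.isStarProjection c).isSelfAdjoint.star_eq, ← star_mul,
      ← star_mul, ← star_mul, ht.mul_id]
  · rw [mul_zero, zero_mul, mul_zero, zero_mul]
    exact Submodule.zero_mem _

end Family

end KGraph

/-! ### Boundary paths and the use of aperiodicity -/

namespace KGraph

section BoundaryPaths

variable {k : ℕ} {Λ : Type u} [Category.{v} Λ] [KGraph k Λ]

/-- The join of two vertices of `Ω_{k,m}`. -/
def Omega.sup {m : Fin k → ℕ∞} (p q : Omega m) : Omega m :=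
  ⟨p.pt ⊔ q.pt, fun i => by
    rcases le_total (p.pt i) (q.pt i) with h | h
    · rw [Pi.sup_apply, sup_eq_right.mpr h]
      exact q.le i
    · rw [Pi.sup_apply, sup_eq_left.mpr h]
      exact p.le i⟩

namespace PathMorphism

/-- At such a `p` there is no edge of colour `i` in `Ω`, so the boundary condition applies. Its
conclusion puts the trivial path in `Λ^{≤ e_i}(x(p))`, and the emptiness clause of that membership
is the claim. -/
theorem IsBoundary.paths_eq_empty {x : PathMorphism Λ} (hx : x.IsBoundary) {p : Omega x.degree}
    {i : Fin k} (hp : (p.pt i : ℕ∞) = x.degree i) : paths (e i) (x.toFunctor.obj p) = ∅ := by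
  have hno : ∀ q : Σ q : Omega x.degree, q ⟶ p, e i ≤ deg q.2 → False := by
    rintro ⟨q, f⟩ h
    have h1 := q.le i
    have h2 := h i
    rw [← hp] at h1
    have h3 : q.pt i ≤ p.pt i := by exact_mod_cast h1
    simp only [Omega.deg_eq, Pi.sub_apply, e, Pi.single_eq_same] at h2
    omega
  have h : pathsUpTo (e i) p = {⟨p, 𝟙 p⟩} := by
    ext ⟨q, f⟩
    constructor
    · rintro ⟨h1, -⟩
      have hle : p.pt ≤ q.pt := f.down
      have hqp : q = p := by
        ext j
        have h2 : q.pt j - p.pt j ≤ e i j := h1 j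
        have h3 : p.pt j ≤ q.pt j := hle j
        by_cases hj : j = i
        · subst hj
          have h4 := q.le j
          rw [← hp] at h4
          have h5 : q.pt j ≤ p.pt j := by exact_mod_cast h4
          exact le_antisymm h5 h3
        · rw [e, Pi.single_eq_of_ne hj] at h2
          omega
      subst hqp
      exact congrArg _ (Subsingleton.elim _ _)
    · rintro h
      cases h
      refine ⟨by rw [deg_id]; exact fun _ => Nat.zero_le _, fun j hj => ?_⟩
      rw [deg_id, zero_add] at hj
      have hji : j = i := by
        by_contra hne
        have := hj j
        simp [e, Pi.single_eq_of_ne hne] at this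
      subst hji
      rw [Set.eq_empty_iff_forall_notMem]
      intro l hl
      exact hno l (le_of_eq (Eq.symm hl))
  have h2 := hx p i h
  have h3 : (⟨x.toFunctor.obj p, 𝟙 _⟩ : Σ a : Λ, a ⟶ x.toFunctor.obj p) ∈
      pathsUpTo (e i) (x.toFunctor.obj p) := by
    rw [h2]
    rfl
  refine h3.2 i ?_
  rw [deg_id, zero_add]

/-- Two graph morphisms are equal if they have the same degree and the same initial segments. -/
theorem ext_of_initial {x y : PathMorphism Λ} {a : Λ} (hd : x.degree = y.degree)
    (f : ∀ p : Omega x.degree, x.toFunctor.obj p ⟶ a)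
    (g : ∀ p : Omega y.degree, y.toFunctor.obj p ⟶ a)
    (hf : ∀ {q p : Omega x.degree} (s : q ⟶ p), x.toFunctor.map s ≫ f p = f q)
    (hg : ∀ {q p : Omega y.degree} (s : q ⟶ p), y.toFunctor.map s ≫ g p = g q)
    (h : ∀ (n : Fin k → ℕ) (h1 : ∀ i, (n i : ℕ∞) ≤ x.degree i) (h2 : ∀ i, (n i : ℕ∞) ≤ y.degree i),
      (⟨x.toFunctor.obj ⟨n, h1⟩, f ⟨n, h1⟩⟩ : Σ c : Λ, c ⟶ a) =
        ⟨y.toFunctor.obj ⟨n, h2⟩, g ⟨n, h2⟩⟩) : x = y := by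
  obtain ⟨m, F, hF⟩ := x
  obtain ⟨m', G, hG⟩ := y
  obtain rfl : m = m' := hd
  have hobj : ∀ p, F.obj p = G.obj p := fun p => congrArg Sigma.fst (h p.pt p.le p.le)
  have hFG : F = G := by
    refine Functor.hext hobj fun q p s => ?_
    -- Stated for free vertices so that the equalities of dependent pairs can be eliminated; unique
    -- factorisation then identifies the two remaining factors.
    have aux : ∀ {c d c' d' : Λ} (φ : c ⟶ d) (ψ : c' ⟶ d') (fc : c ⟶ a) (fd : d ⟶ a)
        (gc : c' ⟶ a) (gd : d' ⟶ a), (⟨c, fc⟩ : Σ c : Λ, c ⟶ a) = ⟨c', gc⟩ →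
        (⟨d, fd⟩ : Σ c : Λ, c ⟶ a) = ⟨d', gd⟩ → φ ≫ fd = fc → ψ ≫ gd = gc → HEq φ ψ := by
      intro c d c' d' φ ψ fc fd gc gd h1 h2 h3 h4
      cases h1
      cases h2
      have h5 := factorisation_unique (h3.trans h4.symm) rfl
      simp only [Sigma.mk.injEq, heq_eq_eq, Prod.mk.injEq, and_true, true_and] at h5
      exact heq_of_eq h5
    exact aux _ _ _ _ _ _ (h q.pt q.le q.le) (h p.pt p.le p.le) (hf s) (hg s)
  subst hFG
  rfl

/-- The initial segment `x(0, M)`. -/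
def initial (x : PathMorphism Λ) (M : Omega x.degree) : x.toFunctor.obj M ⟶ x.range :=
  x.toFunctor.map (Omega.hom (Omega.zero_le M))

theorem deg_initial (x : PathMorphism Λ) (M : Omega x.degree) : deg (x.initial M) = M.pt := by
  rw [initial, x.deg_map, Omega.deg_eq]
  exact tsub_zero _

theorem map_initial (x : PathMorphism Λ) {M M' : Omega x.degree} (h : M'.pt ≤ M.pt) :
    x.toFunctor.map (Omega.hom h) ≫ x.initial M' = x.initial M := by
  rw [initial, initial, ← Functor.map_comp]
  rfl

/-- If all `α x(0, M)` and `β x(0, M)` have common extensions, then `α x = β x`. -/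
theorem IsBoundary.cons_eq_cons {x : PathMorphism Λ} (hx : x.IsBoundary) {a : Λ}
    (α β : x.range ⟶ a)
    (h : ∀ M : Omega x.degree, ∃ (c : Λ) (γ δ : c ⟶ x.toFunctor.obj M),
      γ ≫ x.initial M ≫ α = δ ≫ x.initial M ≫ β) : x.cons α = x.cons β := by
  have hd : x.consDegree α = x.consDegree β := by
    funext i
    rw [consDegree, consDegree]
    induction hi : x.degree i using ENat.recTopCoe with
    | top => simp
    | coe n =>
      -- The vertex `n e_i` is already at the end of `x` in direction `i`, so `γ` and `δ` have
      -- degree `0` there and comparing degrees gives `d(α)_i = d(β)_i`. In an infinite direction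
      -- both sums are `∞`.
      obtain ⟨c, γ, δ, hγδ⟩ := h ⟨Pi.single i n, fun j => by
        by_cases hj : j = i
        · subst hj
          simp [hi]
        · simp [Pi.single_eq_of_ne hj]⟩
      have hemp := hx.paths_eq_empty (p := ⟨Pi.single i n, fun j => by
        by_cases hj : j = i
        · subst hj
          simp [hi]
        · simp [Pi.single_eq_of_ne hj]⟩) (i := i) (by simp [hi])
      have h1 := congrFun (congrArg deg hγδ) i
      simp only [deg_comp, Pi.add_apply, deg_apply_eq_zero hemp, deg_initial] at h1
      have h2 : deg α i = deg β i := by omega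
      rw [h2]
  refine ext_of_initial (a := a) hd (fun q => (x.consSplit α q).2.2)
    (fun q => (x.consSplit β q).2.2) (fun s => x.consMap_comp α s) (fun s => x.consMap_comp β s) ?_
  intro n h1 h2
  set q : Omega (x.consDegree α) := ⟨n, h1⟩
  set q' : Omega (x.consDegree β) := ⟨n, h2⟩
  -- For this `M`, both segments of degree `n` are initial segments of the same path `α x(0,M) γ = β
  -- x(0,M) δ`, hence equal.
  let M : Omega x.degree := (x.consShift α q).sup (x.consShift β q')
  obtain ⟨c, γ, δ, hγδ⟩ := h M
  have hseg : ∀ (α : x.range ⟶ a) (q : Omega (x.consDegree α)) (hq : (x.consShift α q).pt ≤ M.pt)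
      (γ : c ⟶ x.toFunctor.obj M), (γ ≫ x.toFunctor.map (Omega.hom hq) ≫ (x.consSplit α q).2.1) ≫
        (x.consSplit α q).2.2 = γ ≫ x.initial M ≫ α := by
    intro α q hq γ
    rw [Category.assoc, Category.assoc]
    have h3 : (x.consSplit α q).2.1 ≫ (x.consSplit α q).2.2 = x.consPath α q := split_comp _ _ _
    rw [h3, consPath]
    change γ ≫ x.toFunctor.map (Omega.hom hq) ≫ x.initial _ ≫ α = _
    rw [← Category.assoc (x.toFunctor.map _), map_initial]
  have h4 := factorisation_unique
    ((hseg α q le_sup_left γ).trans (hγδ.trans (hseg β q' le_sup_right δ).symm))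
    (by rw [deg_consSplit, deg_consSplit])
  exact congrArg (fun s : Σ d : Λ, (c ⟶ d) × (d ⟶ a) => (⟨s.1, s.2.2⟩ : Σ d : Λ, d ⟶ a)) h4

variable [RowFinite Λ] {B : Type w} [NonUnitalCStarAlgebra B] {t : ∀ ⦃a b : Λ⦄, (a ⟶ b) → B}

/-- The compression equals `t_{α x(0,M)}⋆ t_{β x(0,M)}`. If it were nonzero for every `M`, the two
paths would always have a common extension, forcing `α x = β x`. -/
theorem IsBoundary.exists_initial_mul_eq_zero {x : PathMorphism Λ} (hx : x.IsBoundary)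
    (ht : IsCKFamily t) {a : Λ} {α β : x.range ⟶ a} (h : x.cons α ≠ x.cons β) :
    ∃ M : Omega x.degree, star (t (x.initial M)) * (star (t α) * t β) * t (x.initial M) = 0 := by
  by_contra hno
  push Not at hno
  refine h (hx.cons_eq_cons α β fun M => ht.exists_comp_eq_comp ?_)
  rw [ht.map_comp, ht.map_comp, star_mul]
  simpa only [mul_assoc] using hno M

theorem initial_mul_eq_zero_of_le {x : PathMorphism Λ} (ht : IsCKFamily t) {M M' : Omega x.degree}
    (h : M.pt ≤ M'.pt) {b : B} (hb : star (t (x.initial M)) * b * t (x.initial M) = 0) :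
    star (t (x.initial M')) * b * t (x.initial M') = 0 := by
  rw [← map_initial x h, ht.map_comp, star_mul]
  set s := t (x.toFunctor.map (Omega.hom h))
  calc star s * star (t (x.initial M)) * b * (t (x.initial M) * s)
      = star s * (star (t (x.initial M)) * b * t (x.initial M)) * s := by simp only [mul_assoc]
    _ = 0 := by rw [hb, mul_zero, zero_mul]

/-- Finitely many elements that are each annihilated by compression to some initial segment are
annihilated by compression to a common one. -/
theorem exists_initial_mul_eq_zero_of_finset {x : PathMorphism Λ} (ht : IsCKFamily t)
    {ι : Type*} (s : Finset ι) (b : ι → B)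
    (h : ∀ i ∈ s, ∃ M : Omega x.degree, star (t (x.initial M)) * b i * t (x.initial M) = 0) :
    ∃ M : Omega x.degree, ∀ i ∈ s, star (t (x.initial M)) * b i * t (x.initial M) = 0 := by
  classical
  induction s using Finset.induction_on with
  | empty => exact ⟨Omega.zero _, by simp⟩
  | insert i s hi ih =>
    obtain ⟨M, hM⟩ := ih fun j hj => h j (Finset.mem_insert_of_mem hj)
    obtain ⟨M', hM'⟩ := h i (Finset.mem_insert_self i s)
    refine ⟨M.sup M', fun j hj => ?_⟩
    rcases Finset.mem_insert.mp hj with rfl | hj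
    · exact initial_mul_eq_zero_of_le ht le_sup_right hM'
    · exact initial_mul_eq_zero_of_le ht le_sup_left (hM j hj)

end PathMorphism

end BoundaryPaths

end KGraph

/-! ### The compression estimate -/

namespace KGraph

section Core

variable {k : ℕ} {Λ : Type u} [Category.{v} Λ] [KGraph k Λ] [RowFinite Λ]
  {B : Type w} [NonUnitalCStarAlgebra B] {t : ∀ ⦃a b : Λ⦄, (a ⟶ b) → B}

/-- The coefficients of `t_λ t_μ⋆ = ∑ t_{λα} t_{μα}⋆`, where `d(λ) = d(μ) ≤ q` and the sum is over
`α ∈ Λ^{≤ q - d(λ)}(s(λ))`. -/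
noncomputable def coreCoeff (q : Fin k → ℕ) (j : Span Λ) : Mor Λ × Mor Λ →₀ ℂ :=
  ∑ α ∈ (finite_pathsUpTo (q - deg j.hom₁) j.src).toFinset,
    Finsupp.single (⟨_, _, α.2 ≫ j.hom₁⟩, ⟨_, _, α.2 ≫ j.hom₂⟩) 1

/-- The product `t_p t_{p'}⋆`. -/
def pairEval (t : ∀ ⦃a b : Λ⦄, (a ⟶ b) → B) (x : Mor Λ × Mor Λ) : B :=
  t x.1.hom * star (t x.2.hom)

theorem IsCKFamily.linearCombination_coreCoeff (ht : IsCKFamily t) (q : Fin k → ℕ) (j : Span Λ) :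
    Finsupp.linearCombination ℂ (pairEval t) (coreCoeff q j) = j.eval t := by
  rw [coreCoeff, map_sum, Span.eval, ht.mul_star_eq_sum j.hom₁ j.hom₂ (q - deg j.hom₁)]
  refine Finset.sum_congr rfl fun α _ => ?_
  rw [Finsupp.linearCombination_single, one_smul]
  rfl

/-- Since `d(λ) = d(μ)`, the same extensions `α` bring both `λ` and `μ` to the level `q`. -/
theorem coreCoeff_mem_supported {q : Fin k → ℕ} {j : Span Λ} (hq : deg j.hom₁ ≤ q)
    (hj : deg j.hom₁ = deg j.hom₂) : coreCoeff q j ∈ Finsupp.supported ℂ ℂ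
      {x : Mor Λ × Mor Λ | x.1.IsUpTo q ∧ x.2.IsUpTo q ∧ deg x.1.hom = deg x.2.hom ∧
        x.1.src = x.2.src} := by
  refine Submodule.sum_mem _ fun α hα => ?_
  have hα' := (finite_pathsUpTo _ _).mem_toFinset.mp hα
  refine Finsupp.single_mem_supported ℂ 1 ⟨?_, ?_, ?_, rfl⟩
  · exact Mor.isUpTo_extend (p := ⟨_, _, j.hom₁⟩) hq hα'
  · rw [hj] at hq hα'
    exact Mor.isUpTo_extend (p := ⟨_, _, j.hom₂⟩) hq hα'
  · simp only [deg_comp, hj]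

/-- Compression by `t_p`, `t_{p'}` and a long enough initial segment of an aperiodic boundary path
annihilates the products `t_λ t_μ⋆` with `d(λ) ≠ d(μ)`. -/
theorem PathMorphism.IsBoundary.exists_initial_mul_eval_mul_eq_zero {x : PathMorphism Λ}
    (hx : x.IsBoundary)
    (hcons : ∀ (a b : Λ) (α : x.range ⟶ a) (β : x.range ⟶ b),
      (⟨a, α⟩ : Σ c : Λ, x.range ⟶ c) ≠ ⟨b, β⟩ → x.cons α ≠ x.cons β)
    (ht : IsCKFamily t) {q : Fin k → ℕ} {p p' : Mor Λ} (hp : p.IsUpTo q) (hp' : p'.IsUpTo q)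
    (hdeg : deg p.hom = deg p'.hom) (hsrc : p.src = x.range) (hsrc' : p'.src = x.range)
    {j : Span Λ} (hj₁ : deg j.hom₁ ≤ q) (hj₂ : deg j.hom₂ ≤ q) (hj : deg j.hom₁ ≠ deg j.hom₂) :
    ∃ M : Omega x.degree,
      star (t (x.initial M)) * (star (t p.hom) * j.eval t * t p'.hom) * t (x.initial M) = 0 := by
  obtain ⟨a, b, l⟩ := p
  obtain ⟨a', b', l'⟩ := p'
  obtain ⟨s, c, c', σ, τ⟩ := j
  dsimp only at hdeg hsrc hsrc' hj₁ hj₂ hj ⊢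
  subst hsrc
  subst hsrc'
  by_cases h1 : star (t σ) * t l = 0
  · refine ⟨Omega.zero _, ?_⟩
    have h2 : star (t l) * t σ = 0 := by
      rw [← star_inj, star_mul, star_star, h1, star_zero]
    rw [Span.eval, ← mul_assoc (star (t l)), h2]
    simp only [zero_mul, mul_zero]
  by_cases h2 : star (t τ) * t l' = 0
  · refine ⟨Omega.zero _, ?_⟩
    rw [Span.eval, ← mul_assoc (star (t l)), mul_assoc _ _ (t l'), h2]
    simp only [zero_mul, mul_zero]
  obtain ⟨α, hα⟩ := ht.star_mul_of_isUpTo (σ := ⟨s, c, σ⟩) hj₁ hp h1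
  obtain ⟨β, hβ⟩ := ht.star_mul_of_isUpTo (σ := ⟨s, c', τ⟩) hj₂ hp' h2
  dsimp only at α β
  simp only [Mor.extend, Mor.mk.injEq, true_and] at hα hβ
  obtain ⟨rfl, hα⟩ := hα
  obtain ⟨rfl, hβ⟩ := hβ
  rw [heq_eq_eq] at hα hβ
  subst hα
  subst hβ
  -- Here `p = σα` and `p' = τβ` have equal degree, so `α = β` would force `d(σ) = d(τ)`.
  have hne : (⟨s, α⟩ : Σ c : Λ, x.range ⟶ c) ≠ ⟨s, β⟩ := by
    intro h
    cases h
    rw [deg_comp, deg_comp] at hdeg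
    exact hj (add_right_cancel hdeg)
  obtain ⟨M, hM⟩ := hx.exists_initial_mul_eq_zero ht (hcons _ _ α β hne)
  refine ⟨M, ?_⟩
  have h3 : star (t (α ≫ σ)) * Span.eval t ⟨s, _, _, σ, τ⟩ * t (β ≫ τ) = star (t α) * t β := by
    rw [Span.eval, ← mul_assoc, ht.star_comp_mul, mul_assoc, ht.star_mul_comp]
  rw [h3, hM]

theorem sum_smul_mul_mul_sum_smul {ι : Type*} [Fintype ι] (ζ η : ι → ℂ) (u : ι → B) (b : B) :
    star (∑ i, ζ i • u i) * b * (∑ i, η i • u i) =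
      ∑ i, ∑ j, (star (ζ i) * η j) • (star (u i) * b * u j) := by
  rw [star_sum, Finset.sum_mul, Finset.sum_mul_sum]
  refine Finset.sum_congr rfl fun i _ => Finset.sum_congr rfl fun j _ => ?_
  rw [star_smul, smul_mul_assoc, smul_mul_smul_comm]

/-- The compression estimate behind the uniqueness theorem: for a nondegenerate Cuntz-Krieger
family `t` of a `k`-graph with condition (B), the norm of a finite sum of products `t_λ t_μ⋆`
bounds the norm of its part with `d(λ) = d(μ)`, formed in any Cuntz-Krieger family.
Local convexity plays no role here: it serves to make nondegenerate families exist. -/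
theorem norm_core_le (hB : ConditionB Λ) (ht : IsCKFamily t) (hne : ∀ v : Λ, t (𝟙 v) ≠ 0)
    {B' : Type w} [NonUnitalCStarAlgebra B'] {T : ∀ ⦃a b : Λ⦄, (a ⟶ b) → B'} (hT : IsCKFamily T)
    (c : Span Λ →₀ ℂ) :
    ‖∑ j ∈ c.support with deg j.hom₁ = deg j.hom₂, c j • j.eval T‖ ≤
      ‖∑ j ∈ c.support, c j • j.eval t‖ := by
  classical
  set A := ∑ j ∈ c.support, c j • j.eval t with hA
  let q : Fin k → ℕ := c.support.sup fun j => deg j.hom₁ ⊔ deg j.hom₂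
  have hq : ∀ j ∈ c.support, deg j.hom₁ ⊔ deg j.hom₂ ≤ q := fun j hj =>
    Finset.le_sup (f := fun j : Span Λ => deg j.hom₁ ⊔ deg j.hom₂) hj
  have hq₁ : ∀ j ∈ c.support, deg j.hom₁ ≤ q := fun j hj => le_sup_left.trans (hq j hj)
  have hq₂ : ∀ j ∈ c.support, deg j.hom₂ ≤ q := fun j hj => le_sup_right.trans (hq j hj)
  let D : Mor Λ × Mor Λ →₀ ℂ :=
    ∑ j ∈ c.support with deg j.hom₁ = deg j.hom₂, c j • coreCoeff q j
  have hDmem : D ∈ Finsupp.supported ℂ ℂ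
      {x : Mor Λ × Mor Λ | x.1.IsUpTo q ∧ x.2.IsUpTo q ∧ deg x.1.hom = deg x.2.hom ∧
        x.1.src = x.2.src} :=
    Submodule.sum_mem _ fun j hj => Submodule.smul_mem _ _
      (coreCoeff_mem_supported (hq₁ j (Finset.mem_filter.mp hj).1) (Finset.mem_filter.mp hj).2)
  have hD : ∀ x ∈ D.support, x.1.IsUpTo q ∧ x.2.IsUpTo q ∧ deg x.1.hom = deg x.2.hom ∧
      x.1.src = x.2.src := fun x hx => (Finsupp.mem_supported ℂ D).mp hDmem hx
  let Y : Finset (Mor Λ) := D.support.image Prod.fst ∪ D.support.image Prod.snd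
  have hY : ∀ p ∈ Y, p.IsUpTo q := by
    intro p hp
    rcases Finset.mem_union.mp hp with h | h
    · obtain ⟨x, hx, rfl⟩ := Finset.mem_image.mp h
      exact (hD x hx).1
    · obtain ⟨x, hx, rfl⟩ := Finset.mem_image.mp h
      exact (hD x hx).2.1
  have hDY : D.support ⊆ Y ×ˢ Y := fun x hx => Finset.mem_product.mpr
    ⟨Finset.mem_union_left _ (Finset.mem_image_of_mem _ hx),
      Finset.mem_union_right _ (Finset.mem_image_of_mem _ hx)⟩
  let C : Matrix Y Y ℂ := fun i j => D (i.1, j.1)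
  have hCne : ∀ i j : Y, C i j ≠ 0 → deg i.1.hom = deg j.1.hom ∧ i.1.src = j.1.src :=
    fun i j h => (hD (i.1, j.1) (Finsupp.mem_support_iff.mpr h)).2.2
  have hcore : ∀ {B' : Type w} [NonUnitalCStarAlgebra B'] {T : ∀ ⦃a b : Λ⦄, (a ⟶ b) → B'},
      IsCKFamily T → ∑ j ∈ c.support with deg j.hom₁ = deg j.hom₂, c j • j.eval T =
        ∑ i : Y, ∑ j : Y, C i j • (T i.1.hom * star (T j.1.hom)) := by
    intro B' _ T hT
    have h1 : Finsupp.linearCombination ℂ (pairEval T) D =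
        ∑ j ∈ c.support with deg j.hom₁ = deg j.hom₂, c j • j.eval T := by
      rw [map_sum]
      exact Finset.sum_congr rfl fun j _ => by rw [map_smul, hT.linearCombination_coreCoeff]
    rw [← h1, Finsupp.linearCombination_apply, Finsupp.sum_of_support_subset _ hDY _ (by simp),
      Finset.sum_product, ← Finset.sum_coe_sort]
    exact Finset.sum_congr rfl fun i _ => (Finset.sum_coe_sort Y _).symm
  have horth : ∀ {B' : Type w} [NonUnitalCStarAlgebra B'] {T : ∀ ⦃a b : Λ⦄, (a ⟶ b) → B'},
      IsCKFamily T → ∀ i j : Y, i ≠ j → star (T i.1.hom) * T j.1.hom = 0 :=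
    fun hT i j hij => hT.star_mul_eq_zero (hY _ i.2) (hY _ j.2) fun h => hij (Subtype.ext h)
  rw [hcore hT]
  -- Blocks are indexed by degree as well as source: the equal degrees are what makes the terms with
  -- `d(λ) ≠ d(μ)` disappear under compression.
  refine norm_sum_smul_mul_star_le (Q := fun i : Y => T (𝟙 i.1.src)) (horth hT)
    (fun i => hT.star_mul_self _) (fun i => hT.mul_id _) (fun i j h => by rw [(hCne i j h).2])
    (norm_nonneg A) (Matrix.posSemidef_sub_mul_conjTranspose_of_blocks
      (fun i : Y => (deg i.1.hom, i.1.src)) C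
      (fun i j h => Prod.ext (hCne i j h).1 (hCne i j h).2) _ ?_)
  rintro ⟨n, v⟩ ζ η hζ hη
  obtain ⟨x, hx, rfl, hcons⟩ := hB v
  have hcompr : ∀ i j : Y, i.1.src = x.range → j.1.src = x.range →
      star (t i.1.hom) * (∑ r : Y, ∑ r' : Y, C r r' • (t r.1.hom * star (t r'.1.hom))) * t j.1.hom =
        C i j • t (𝟙 x.range) := by
    intro i j hi hj
    have h1 : ∀ r r' : Y, star (t i.1.hom) * (t r.1.hom * star (t r'.1.hom)) * t j.1.hom =
        if i = r then if r' = j then t (𝟙 x.range) else 0 else 0 := by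
      intro r r'
      rw [← mul_assoc, mul_assoc _ _ (t j.1.hom)]
      split_ifs with h h'
      · subst h h'
        rw [ht.star_mul_self, ht.star_mul_self, hi, hj]
        exact (ht.isStarProjection _).isIdempotentElem
      · rw [horth ht r' j h', mul_zero]
      · rw [horth ht i r h, zero_mul]
    simp_rw [Finset.mul_sum, Finset.sum_mul, mul_smul_comm, smul_mul_assoc, h1]
    simp
  -- Only finitely many terms and pairs of paths in the block occur, so a single `M` serves them
  -- all.
  obtain ⟨M, hM⟩ := PathMorphism.exists_initial_mul_eq_zero_of_finset (x := x) ht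
    ((c.support.filter fun j => ¬ deg j.hom₁ = deg j.hom₂) ×ˢ
      ((Finset.univ : Finset Y).filter fun i => (deg i.1.hom, i.1.src) = (n, x.range)) ×ˢ
      ((Finset.univ : Finset Y).filter fun i => (deg i.1.hom, i.1.src) = (n, x.range)))
    (fun y => star (t y.2.1.1.hom) * y.1.eval t * t y.2.2.1.hom) (by
      rintro ⟨j, i, i'⟩ h
      simp only [Finset.mem_product, Finset.mem_filter, Prod.mk.injEq, Finset.mem_univ,
        true_and] at h
      obtain ⟨⟨h1, h2⟩, ⟨h3, h4⟩, h5, h6⟩ := h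
      exact hx.exists_initial_mul_eval_mul_eq_zero hcons ht (hY _ i.2) (hY _ i'.2)
        (h3.trans h5.symm) h4 h6 (hq₁ j h1) (hq₂ j h1) h2)
  set ξ := x.initial M
  set P := t (𝟙 (x.toFunctor.obj M)) with hP
  have hξ : star (t ξ) * t (𝟙 x.range) * t ξ = P := by
    rw [mul_assoc, ht.id_mul, ht.star_mul_self]
  let W : (Y → ℂ) → B := fun ζ => ∑ i, ζ i • (t i.1.hom * t ξ)
  have hA' : A = (∑ r : Y, ∑ r' : Y, C r r' • (t r.1.hom * star (t r'.1.hom))) +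
      ∑ j ∈ c.support with ¬ deg j.hom₁ = deg j.hom₂, c j • j.eval t := by
    rw [← hcore ht, hA, Finset.sum_filter_add_sum_filter_not]
  have hWA : star (W ζ) * A * W η = (∑ i, ∑ j, star (ζ i) * C i j * η j) • P := by
    rw [sum_smul_mul_mul_sum_smul, Finset.sum_smul]
    refine Finset.sum_congr rfl fun i _ => ?_
    rw [Finset.sum_smul]
    refine Finset.sum_congr rfl fun j _ => ?_
    by_cases hi : (deg i.1.hom, i.1.src) = (n, x.range)
    swap
    · rw [hζ i hi]; simp
    by_cases hj : (deg j.1.hom, j.1.src) = (n, x.range)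
    swap
    · rw [hη j hj]; simp
    have h1 : star (t i.1.hom * t ξ) * A * (t j.1.hom * t ξ) =
        star (t ξ) * (star (t i.1.hom) * A * t j.1.hom) * t ξ := by
      simp only [star_mul, mul_assoc]
    rw [h1, hA', mul_add, add_mul, mul_add, add_mul,
      hcompr i j (congrArg Prod.snd hi) (congrArg Prod.snd hj), Finset.mul_sum, Finset.sum_mul,
      Finset.mul_sum, Finset.sum_mul, Finset.sum_eq_zero, add_zero, mul_smul_comm, smul_mul_assoc,
      hξ, smul_smul, mul_right_comm]
    intro l hl
    rw [mul_smul_comm, smul_mul_assoc, mul_smul_comm, smul_mul_assoc,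
      hM (l, i, j) (Finset.mem_product.mpr ⟨hl, Finset.mem_product.mpr
        ⟨Finset.mem_filter.mpr ⟨Finset.mem_univ _, hi⟩,
          Finset.mem_filter.mpr ⟨Finset.mem_univ _, hj⟩⟩⟩), smul_zero]
  have hPnorm : ‖P‖ = 1 := (ht.isStarProjection _).norm_eq_one (hne _)
  have hW : ∀ θ : Y → ℂ, (∀ i : Y, (deg i.1.hom, i.1.src) ≠ (n, x.range) → θ i = 0) →
      ‖W θ‖ ^ 2 = ∑ i, ‖θ i‖ ^ 2 := by
    intro θ hθ
    have h1 : star (W θ) * W θ = ((∑ i, ‖θ i‖ ^ 2 : ℝ) : ℂ) • P := by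
      change star (∑ i, θ i • (t i.1.hom * t ξ)) * (∑ i, θ i • (t i.1.hom * t ξ)) = _
      rw [star_sum, Finset.sum_mul_sum, Complex.ofReal_sum, Finset.sum_smul]
      refine Finset.sum_congr rfl fun i _ => ?_
      rw [Finset.sum_eq_single i]
      · by_cases hi : (deg i.1.hom, i.1.src) = (n, x.range)
        · rw [star_smul, smul_mul_smul_comm, star_mul, mul_assoc, ← mul_assoc (star (t i.1.hom)),
            ht.star_mul_self, show i.1.src = x.range from congrArg Prod.snd hi, ← mul_assoc, hξ, Complex.star_def, mul_comm,
            Complex.mul_conj, Complex.normSq_eq_norm_sq]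
        · rw [hθ i hi]; simp
      · intro j _ hji
        rw [star_smul, smul_mul_smul_comm, star_mul, mul_assoc, ← mul_assoc (star (t i.1.hom)),
          horth ht i j hji.symm, zero_mul, mul_zero, smul_zero]
      · exact fun h => absurd (Finset.mem_univ i) h
    have h2 := CStarRing.norm_star_mul_self (x := W θ)
    rw [h1, norm_smul, hPnorm, mul_one, Complex.norm_real,
      Real.norm_of_nonneg (Finset.sum_nonneg fun _ _ => by positivity)] at h2
    rw [h2, sq]
  have h1 : ‖∑ i, ∑ j, star (ζ i) * C i j * η j‖ ≤ ‖W ζ‖ * ‖A‖ * ‖W η‖ := by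
    calc ‖∑ i, ∑ j, star (ζ i) * C i j * η j‖ = ‖star (W ζ) * A * W η‖ := by
          rw [hWA, norm_smul, hPnorm, mul_one]
      _ ≤ ‖star (W ζ)‖ * ‖A‖ * ‖W η‖ :=
          (norm_mul_le _ _).trans (mul_le_mul_of_nonneg_right (norm_mul_le _ _) (norm_nonneg _))
      _ = _ := by rw [norm_star]
  calc ‖∑ i, ∑ j, star (ζ i) * C i j * η j‖ ^ 2 ≤ (‖W ζ‖ * ‖A‖ * ‖W η‖) ^ 2 :=
        pow_le_pow_left₀ (norm_nonneg _) h1 2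
    _ = ‖A‖ ^ 2 * ‖W ζ‖ ^ 2 * ‖W η‖ ^ 2 := by ring
    _ = _ := by rw [hW ζ hζ, hW η hη]

end Core

end KGraph

/-! ### Fourier monomials on the torus -/

namespace KGraph

section Torus

open MeasureTheory UnitAddTorus

/-- The normalised Haar measure of the torus. -/
noncomputable def torusMeasure (k : ℕ) : Measure (UnitAddTorus (Fin k)) :=
  Measure.pi fun _ => AddCircle.haarAddCircle

instance (k : ℕ) : IsProbabilityMeasure (torusMeasure k) :=
  inferInstanceAs (IsProbabilityMeasure (Measure.pi _))

instance (k : ℕ) : (torusMeasure k).IsOpenPosMeasure :=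
  inferInstanceAs (Measure.pi _).IsOpenPosMeasure

/-- Translation by `1/(2n)` preserves the measure and changes the sign of the integrand. -/
theorem integral_fourier {n : ℤ} (hn : n ≠ 0) :
    ∫ z : UnitAddCircle, fourier n z ∂AddCircle.haarAddCircle = 0 :=
  integral_eq_zero_of_add_right_eq_neg (μ := AddCircle.haarAddCircle)
    (fourier_add_half_inv_index hn one_pos)

theorem integral_mFourier {k : ℕ} (n : Fin k → ℤ) :
    ∫ z, mFourier n z ∂torusMeasure k = if n = 0 then 1 else 0 := by
  split_ifs with h
  · subst h
    simp [mFourier_zero]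
  · obtain ⟨i, hi⟩ := Function.ne_iff.mp h
    have h1 : ∫ z, mFourier n z ∂torusMeasure k =
        ∏ i, ∫ z : UnitAddCircle, fourier (n i) z ∂AddCircle.haarAddCircle :=
      integral_fintype_prod_eq_prod (fun i (z : UnitAddCircle) => fourier (n i) z)
    rw [h1]
    exact Finset.prod_eq_zero (Finset.mem_univ i) (integral_fourier hi)

/-- The monomial `z ^ n`. -/
noncomputable def torusPow {k : ℕ} (n : Fin k → ℕ) (z : UnitAddTorus (Fin k)) : ℂ :=
  mFourier (fun i => (n i : ℤ)) z

variable {k : ℕ} (z : UnitAddTorus (Fin k))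

theorem torusPow_zero : torusPow 0 z = 1 := by
  have : (fun i : Fin k => (((0 : Fin k → ℕ) i : ℕ) : ℤ)) = 0 := by
    funext
    simp
  rw [torusPow, this, mFourier_zero]
  rfl

theorem torusPow_add (m n : Fin k → ℕ) : torusPow (m + n) z = torusPow m z * torusPow n z := by
  rw [torusPow, torusPow, torusPow, ← mFourier_add]
  congr 2

theorem torusPow_mul_star (m n : Fin k → ℕ) : torusPow m z * star (torusPow n z) =
    mFourier ((fun i => (m i : ℤ)) + -fun i => (n i : ℤ)) z := by
  rw [mFourier_add, mFourier_neg]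
  rfl

theorem star_torusPow_mul_self (n : Fin k → ℕ) : star (torusPow n z) * torusPow n z = 1 := by
  rw [mul_comm, torusPow_mul_star, add_neg_cancel, mFourier_zero]
  rfl

theorem torusPow_zero_right (n : Fin k → ℕ) : torusPow n 0 = 1 := by
  simp [torusPow, mFourier]

end Torus

/-! ### Gauge twists and their average -/

section Gauge

variable {k : ℕ} {Λ : Type u} [Category.{v} Λ] [KGraph k Λ] [RowFinite Λ]

/-- The family `z ^ {d(λ)} t_λ`. -/
theorem IsCKFamily.twist {B : Type w} [NonUnitalCStarAlgebra B] {t : ∀ ⦃a b : Λ⦄, (a ⟶ b) → B}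
    (ht : IsCKFamily t) (z : UnitAddTorus (Fin k)) :
    IsCKFamily (fun ⦃a b : Λ⦄ (l : a ⟶ b) => torusPow (deg l) z • t l) where
  partialIsometry l := by
    rw [star_smul, smul_mul_smul_comm, smul_mul_smul_comm, ht.partialIsometry, mul_assoc,
      star_torusPow_mul_self, mul_one]
  isStarProjection v := by
    rw [deg_id, torusPow_zero, one_smul]
    exact ht.isStarProjection v
  orthogonal v v' h := by
    rw [smul_mul_smul_comm, ht.orthogonal v v' h, smul_zero]
  map_comp μ l := by
    rw [deg_comp, torusPow_add, smul_mul_smul_comm, ht.map_comp]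
  star_mul_self l := by
    rw [star_smul, smul_mul_smul_comm, star_torusPow_mul_self, ht.star_mul_self, deg_id,
      torusPow_zero]
  sum_eq v m := by
    rw [deg_id, torusPow_zero, one_smul, ht.sum_eq v m]
    refine Finset.sum_congr rfl fun l _ => ?_
    rw [star_smul, smul_mul_smul_comm, mul_comm, star_torusPow_mul_self, one_smul]

/-- The Cuntz-Krieger family `P` multiplied by `z ^ d`. -/
noncomputable def CKPair.twist (P : CKPair.{u, v, w} Λ) (z : UnitAddTorus (Fin k)) :
    CKPair.{u, v, w} Λ where
  B := P.B
  t := fun _ _ l => torusPow (deg l) z • P.t l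
  isCKFamily := P.isCKFamily.twist z

/-- The composite of the gauge automorphism at `z` with the representation of `C⋆(Λ)` at `P`. -/
noncomputable def gaugeCoord (P : CKPair.{u, v, w} Λ) (z : UnitAddTorus (Fin k)) :
    CStar.{u, v, w} Λ →⋆ₙₐ[ℂ] P.B :=
  coord (P.twist z)

theorem gaugeCoord_gen (P : CKPair.{u, v, w} Λ) (z : UnitAddTorus (Fin k)) {a b : Λ} (l : a ⟶ b) :
    gaugeCoord P z (gen l) = torusPow (deg l) z • P.t l := rfl

theorem gaugeCoord_zero (P : CKPair.{u, v, w} Λ) : gaugeCoord P 0 = coord P := by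
  refine (existsUnique_hom P.isCKFamily).unique (fun a b l => ?_) (fun a b l => rfl)
  rw [gaugeCoord_gen, torusPow_zero_right, one_smul]

variable (Λ) in
/-- The linear span of the products `s_λ s_μ⋆`. -/
noncomputable def genSpan : Submodule ℂ (CStar.{u, v, w} Λ) := Submodule.span ℂ (Set.range (Span.eval gen))

theorem mul_mem_genSpan {x y : CStar.{u, v, w} Λ} (hx : x ∈ genSpan Λ) (hy : y ∈ genSpan Λ) :
    x * y ∈ genSpan Λ := by
  obtain ⟨c, rfl⟩ := Finsupp.mem_span_range_iff_exists_finsupp.mp hx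
  obtain ⟨d, rfl⟩ := Finsupp.mem_span_range_iff_exists_finsupp.mp hy
  rw [Finsupp.sum, Finsupp.sum, Finset.sum_mul_sum]
  refine Submodule.sum_mem _ fun i _ => Submodule.sum_mem _ fun j _ => ?_
  rw [smul_mul_smul_comm]
  exact Submodule.smul_mem _ _ (isCKFamily_gen.eval_mul_eval_mem i j)

theorem star_mem_genSpan {x : CStar.{u, v, w} Λ} (hx : x ∈ genSpan Λ) : star x ∈ genSpan Λ := by
  obtain ⟨c, rfl⟩ := Finsupp.mem_span_range_iff_exists_finsupp.mp hx
  rw [Finsupp.sum, star_sum]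
  refine Submodule.sum_mem _ fun j _ => ?_
  rw [star_smul]
  refine Submodule.smul_mem _ _ (Submodule.subset_span ⟨⟨_, _, _, j.hom₂, j.hom₁⟩, ?_⟩)
  rw [Span.eval, Span.eval, star_mul, star_star]

theorem mem_closure_genSpan (y : CStar.{u, v, w} Λ) :
    y ∈ closure (genSpan Λ : Set (CStar.{u, v, w} Λ)) := by
  rw [closure_subtype]
  have h1 : ((NonUnitalStarAlgebra.adjoin ℂ
      {y | ∃ (a b : Λ) (l : a ⟶ b), y = genProd.{u, v, w} l} : NonUnitalStarSubalgebra ℂ _) :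
      Set (lp (fun P : CKPair.{u, v, w} Λ => P.B) ∞)) ⊆ (↑) '' (genSpan Λ : Set (CStar Λ)) := by
    intro x hx
    induction hx using NonUnitalStarAlgebra.adjoin_induction with
    | mem x hx =>
      obtain ⟨a, b, l, rfl⟩ := hx
      refine ⟨gen l, Submodule.subset_span ⟨⟨a, b, a, l, 𝟙 a⟩, ?_⟩, rfl⟩
      rw [Span.eval, (isCKFamily_gen.isStarProjection a).isSelfAdjoint.star_eq,
        isCKFamily_gen.mul_id]
    | add x y _ _ hx hy =>
      obtain ⟨x, hx, rfl⟩ := hx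
      obtain ⟨y, hy, rfl⟩ := hy
      exact ⟨x + y, Submodule.add_mem _ hx hy, rfl⟩
    | zero => exact ⟨0, Submodule.zero_mem _, rfl⟩
    | mul x y _ _ hx hy =>
      obtain ⟨x, hx, rfl⟩ := hx
      obtain ⟨y, hy, rfl⟩ := hy
      exact ⟨x * y, mul_mem_genSpan hx hy, rfl⟩
    | smul r x _ hx =>
      obtain ⟨x, hx, rfl⟩ := hx
      exact ⟨r • x, Submodule.smul_mem _ r hx, rfl⟩
    | star x _ hx =>
      obtain ⟨x, hx, rfl⟩ := hx
      exact ⟨star x, star_mem_genSpan hx, rfl⟩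
  exact closure_mono h1 y.2

theorem gaugeCoord_eval (P : CKPair.{u, v, w} Λ) (z : UnitAddTorus (Fin k)) (j : Span Λ) :
    gaugeCoord P z (j.eval gen) =
      (torusPow (deg j.hom₁) z * star (torusPow (deg j.hom₂) z)) • j.eval P.t := by
  rw [Span.eval, map_mul, map_star, gaugeCoord_gen, gaugeCoord_gen, star_smul, smul_mul_smul_comm]
  rfl

/-- On `genSpan` the function is a trigonometric polynomial. All the homomorphisms `gaugeCoord P z`
are contractive, so approximating `y` approximates uniformly in `z`. -/
theorem continuous_gaugeCoord (P : CKPair.{u, v, w} Λ) (y : CStar.{u, v, w} Λ) :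
    Continuous fun z => gaugeCoord P z y := by
  refine continuous_of_uniform_approx_of_continuous fun U hU => ?_
  obtain ⟨ε, hε, hεU⟩ := Metric.mem_uniformity_dist.mp hU
  obtain ⟨s, hs, hd⟩ := Metric.mem_closure_iff.mp (mem_closure_genSpan y) ε hε
  refine ⟨fun z => gaugeCoord P z s, ?_, fun z => hεU ?_⟩
  · obtain ⟨c, rfl⟩ := Finsupp.mem_span_range_iff_exists_finsupp.mp hs
    simp_rw [Finsupp.sum, map_sum, map_smul, gaugeCoord_eval, torusPow_mul_star]
    fun_prop
  · rw [dist_eq_norm, ← map_sub]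
    rw [dist_eq_norm] at hd
    exact (NonUnitalStarAlgHom.norm_apply_le _ _).trans_lt hd

open MeasureTheory

theorem integrable_gaugeCoord (P : CKPair.{u, v, w} Λ) (y : CStar.{u, v, w} Λ) :
    Integrable (fun z => gaugeCoord P z y) (torusMeasure k) :=
  (continuous_gaugeCoord P y).integrable_of_hasCompactSupport (.of_compactSpace _)

theorem continuous_integral_gaugeCoord (P : CKPair.{u, v, w} Λ) :
    Continuous fun y => ∫ z, gaugeCoord P z y ∂torusMeasure k := by
  refine (LipschitzWith.of_dist_le_mul (K := 1) fun y y' => ?_).continuous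
  rw [dist_eq_norm, dist_eq_norm, ← integral_sub (integrable_gaugeCoord P y)
    (integrable_gaugeCoord P y')]
  refine (norm_integral_le_of_norm_le_const (C := ‖y - y'‖) (ae_of_all _ fun z => ?_)).trans ?_
  · rw [← map_sub]
    exact NonUnitalStarAlgHom.norm_apply_le _ _
  · simp

/-- The twist multiplies `t_λ t_μ⋆` by `z ^ (d(λ) - d(μ))`, whose mean is `1` or `0`. -/
theorem integral_gaugeCoord_sum (P : CKPair.{u, v, w} Λ) (c : Span Λ →₀ ℂ) :
    ∫ z, gaugeCoord P z (∑ j ∈ c.support, c j • j.eval gen) ∂torusMeasure k =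
      ∑ j ∈ c.support with deg j.hom₁ = deg j.hom₂, c j • j.eval P.t := by
  simp_rw [map_sum, map_smul]
  rw [integral_finsetSum (f := fun j z => c j • gaugeCoord P z (j.eval gen)) _
    fun j _ => (integrable_gaugeCoord P _).smul (c j), Finset.sum_filter]
  refine Finset.sum_congr rfl fun j _ => ?_
  rw [integral_smul]
  simp_rw [gaugeCoord_eval, torusPow_mul_star]
  rw [integral_smul_const, integral_mFourier]
  have : ((fun i => (deg j.hom₁ i : ℤ)) + -fun i => (deg j.hom₂ i : ℤ)) = 0 ↔
      deg j.hom₁ = deg j.hom₂ := by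
    rw [add_neg_eq_zero]
    constructor
    · intro h
      funext i
      exact_mod_cast congrFun h i
    · intro h
      rw [h]
  simp_rw [this]
  split_ifs <;> simp

/-- Both sides are continuous in `y`, so finite sums suffice, and for these it is the compression
estimate. -/
theorem norm_integral_gaugeCoord_le (hB : ConditionB Λ) {B : Type w} [NonUnitalCStarAlgebra B]
    {t : ∀ ⦃a b : Λ⦄, (a ⟶ b) → B} (ht : IsCKFamily t) (hne : ∀ v : Λ, t (𝟙 v) ≠ 0)
    {π : CStar.{u, v, w} Λ →⋆ₙₐ[ℂ] B} (hπ : ∀ (a b : Λ) (l : a ⟶ b), π (gen l) = t l)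
    (P : CKPair.{u, v, w} Λ) (y : CStar.{u, v, w} Λ) :
    ‖∫ z, gaugeCoord P z y ∂torusMeasure k‖ ≤ ‖π y‖ := by
  have hc : Continuous π := AddMonoidHomClass.continuous_of_bound π 1 fun y => by
    rw [one_mul]
    exact NonUnitalStarAlgHom.norm_apply_le π y
  refine closure_minimal (t := {y | ‖∫ z, gaugeCoord P z y ∂torusMeasure k‖ ≤ ‖π y‖}) ?_
    (isClosed_le (continuous_integral_gaugeCoord P).norm hc.norm) (mem_closure_genSpan y)
  intro s hs
  obtain ⟨c, rfl⟩ := Finsupp.mem_span_range_iff_exists_finsupp.mp hs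
  have hπc : π (c.sum fun j a => a • j.eval gen) = ∑ j ∈ c.support, c j • j.eval t := by
    simp_rw [Finsupp.sum, map_sum, map_smul, Span.eval, map_mul, map_star, hπ]
  change ‖∫ z, gaugeCoord P z (∑ j ∈ c.support, c j • j.eval gen) ∂torusMeasure k‖ ≤ _
  rw [hπc, integral_gaugeCoord_sum]
  exact norm_core_le hB ht hne P.isCKFamily c

end Gauge

end KGraph

theorem theorem4p3 {k : ℕ} {Λ : Type u} [Category.{v} Λ] [KGraph k Λ] [KGraph.RowFinite Λ]
    (hconv : KGraph.LocallyConvex Λ) (hB : KGraph.ConditionB Λ)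
    {B : Type w} [NonUnitalCStarAlgebra B]
    (t : ∀ ⦃a b : Λ⦄, (a ⟶ b) → B) (ht : KGraph.IsCKFamily t)
    (π : KGraph.CStar.{u, v, w} Λ →⋆ₙₐ[ℂ] B)
    (hπ : ∀ (a b : Λ) (l : a ⟶ b), π (KGraph.gen l) = t l)
    (hne : ∀ v : Λ, t (𝟙 v) ≠ 0) :
    Function.Injective π := by
  rw [injective_iff_map_eq_zero]
  intro y hy
  refine KGraph.ext_coord fun P => ?_
  rw [map_zero, ← KGraph.gaugeCoord_zero]
  refine eq_zero_of_integral_star_mul_self_eq_zero (KGraph.torusMeasure k)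
    (KGraph.continuous_gaugeCoord P y) ?_ 0
  -- The estimate is applied to `y⋆y` to make the integrand positive; the torus is written
  -- additively, so its identity is the point `0`.
  have h := KGraph.norm_integral_gaugeCoord_le hB ht hne hπ P (star y * y)
  rw [map_mul, hy, mul_zero, norm_zero] at h
  simpa only [map_mul, map_star] using norm_le_zero_iff.mp h
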